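/- For $n\ge 1$ let $A_n(x)=\sum_{\pi\in\mathcal S_n}x^{\mathrm{des}(\pi)+1}$ be the $n$-th Eulerian polynomial, where $\mathrm{des}(\pi)$ is the number of descents of $\pi$, i.e. of indices $1\le i\le n-1$ with $\pi(i)>\pi(i+1)$. For $n>2$ and $t\in\mathbb R$ put $A_n(t,x)=A_n(x)+t\,x\,A_{n-2}(x)$, which is divisible by $x$. For $n\ge 1$ and $0\le k\le n-1$ let $W_t(n,k)$ be the number of $t$-stack sortable permutations in $\mathcal S_n$ with exactly $k$ descents (those whose one-line notation becomes the identity after $t$ passes through West's stack-sorting procedure), and let $W_{n,t}(x)=\sum_{k=0}^{n-1}W_t(n,k)x^k$. A polynomial is real- and simple-rooted if all its complex zeros are real and simple. A real-rooted polynomial $f$ with zeros $\alpha_1\le\dots\le\alpha_i$ strictly interlaces a real-rooted polynomial $g$ with zeros $\beta_1\le\dots\le\beta_j$ (zeros counted with multiplicity) if $j=i+1$, $\beta_1\le\alpha_1\le\beta_2\le\dots\le\beta_{i}\le\alpha_{i}\le\beta_{i+1}$, and $f$ and $g$ have no common zero. A finite real sequence $a_0,\dots,a_m$ is a PF (Pólya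 frequency) sequence if, with $a_k=0$ for $k<0$ and $k>m$, all minors of the infinite matrix $(a_{i-j})_{i,j\ge0}$ are nonnegative. Theorem. 1. For all real $t>-2$ and all integers $n>2$, the polynomial $A_n(t,x)$ is real- and simple-rooted. 2. For all real $t$ with $-2<t\le 3$ and all integers $n>2$, $A_n(t,x)/x$ strictly interlaces $A_{n+1}(t,x)/x$. 3. For all integers $n\ge 2$, the sequence $\{W_{n-2}(n,k)\}_{k=0}^{n-1}$ is a PF sequence. 4. For all integers $n>2$, $W_{n,n-2}(x)$ strictly interlaces $W_{n+1,n-1}(x)$. -/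

import Mathlib

namespace StackEulerian

open Polynomial

/-! ### Permutations, descents, Eulerian polynomials -/

/-- The number of descents of a permutation `π` of an `n`-element chain, that is, of positions `i`
such that `i + 1` is a position too and `π i > π (i + 1)`. -/
def des {n : ℕ} (π : Equiv.Perm (Fin n)) : ℕ :=
  (Finset.univ.filter fun i : Fin n => ∃ h : i.val + 1 < n, π ⟨i.val + 1, h⟩ < π i).card

/-- The Eulerian polynomial `A_n(x) = ∑_{π ∈ S_n} x ^ (des π + 1)`, for `n ≥ 1`. -/
noncomputable def eulerianPoly (n : ℕ) : ℝ[X] :=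
  ∑ π : Equiv.Perm (Fin n), X ^ (des π + 1)

/-- The polynomial `A_n(t, x) = A_n(x) + t x A_{n-2}(x)`, for `n > 2`. -/
noncomputable def eulerianPolyT (n : ℕ) (t : ℝ) : ℝ[X] :=
  eulerianPoly n + C t * X * eulerianPoly (n - 2)

/-- The quotient `A_n(t, x) / x`. -/
noncomputable def eulerianPolyTDivX (n : ℕ) (t : ℝ) : ℝ[X] :=
  (eulerianPolyT n t).divX

/-- The division by `x` in `A_n(t, x) / x` is exact. -/
theorem X_mul_eulerianPolyTDivX (n : ℕ) (t : ℝ) :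
    X * eulerianPolyTDivX n t = eulerianPolyT n t := by
  have h0 : (eulerianPolyT n t).coeff 0 = 0 := by
    simp [eulerianPolyT, eulerianPoly, coeff_zero_eq_eval_zero, eval_finsetSum]
  have h := X_mul_divX_add (eulerianPolyT n t)
  rw [h0, C_0, add_zero] at h
  exact h

/-! ### Stack sorting -/

/-- `stackPass s w` is the output still to come from a stack with content `s` (top first) and
remaining input `w`: the next letter `a` of the input first makes all the letters smaller than `a`
leave the stack, from the top, and is then put on the stack; when the input is exhausted, the
stack is emptied from the top. -/
def stackPass : List ℕ → List ℕ → List ℕ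
  | s, [] => s
  | s, a :: w => s.takeWhile (· < a) ++ stackPass (a :: s.dropWhile (· < a)) w

/-- One pass through an initially empty stack (the stack-sorting operator). -/
def stackSort (w : List ℕ) : List ℕ := stackPass [] w

/-- A permutation is `t`-stack sortable if `t` passes of its one-line notation through the stack
give the identity permutation. -/
def IsStackSortable (t : ℕ) {n : ℕ} (π : Equiv.Perm (Fin n)) : Prop :=
  stackSort^[t] (List.ofFn fun i : Fin n => (π i : ℕ)) = List.range n

instance (t : ℕ) {n : ℕ} (π : Equiv.Perm (Fin n)) : Decidable (IsStackSortable t π) :=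
  inferInstanceAs (Decidable (_ = _))

/-- `W_t(n, k)`: the number of `t`-stack sortable permutations in `S_n` with `k` descents. -/
def stackNumber (t n k : ℕ) : ℕ :=
  (Finset.univ.filter fun π : Equiv.Perm (Fin n) => IsStackSortable t π ∧ des π = k).card

/-- `W_{n,t}(x) = ∑_{k=0}^{n-1} W_t(n, k) x ^ k`. -/
noncomputable def stackPoly (n t : ℕ) : ℝ[X] :=
  ∑ k ∈ Finset.range n, C (stackNumber t n k : ℝ) * X ^ k

/-! ### Pólya frequency sequences -/

/-- An infinite matrix is totally positive if all its minors are nonnegative. -/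
def IsTotallyPositive (A : Matrix ℕ ℕ ℝ) : Prop :=
  ∀ (r : ℕ) (f g : Fin r → ℕ), StrictMono f → StrictMono g → 0 ≤ (A.submatrix f g).det

/-- An infinite sequence `a` is a Pólya frequency sequence if the matrix `(a_{i-j})_{i,j ≥ 0}`
(with `a_m = 0` for `m < 0`) is totally positive. -/
def IsPF (a : ℕ → ℝ) : Prop :=
  IsTotallyPositive (Matrix.of fun i j => if j ≤ i then a (i - j) else 0)

/-- A finite sequence `a_0, …, a_{n-1}` is PF if its extension by zeros is. -/
def IsFinitePF {n : ℕ} (a : Fin n → ℝ) : Prop :=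
  IsPF fun k => if h : k < n then a ⟨k, h⟩ else 0

/-! ### Real zeros and interlacing -/

/-- All the complex zeros of the (nonzero) polynomial are real. -/
def IsRealRooted (f : ℝ[X]) : Prop := f ≠ 0 ∧ f.Splits

/-- All the complex zeros are real and simple. -/
def IsRealSimpleRooted (f : ℝ[X]) : Prop := IsRealRooted f ∧ f.roots.Nodup

/-- `f` interlaces `g`: both are real-rooted, and if `α_1 ≤ ⋯ ≤ α_m` and `β_1 ≤ ⋯ ≤ β_j` are the
zeros of `f` and `g`, counted with multiplicity, then `j = m + 1` and
`β_1 ≤ α_1 ≤ β_2 ≤ ⋯ ≤ β_m ≤ α_m ≤ β_{m+1}`. -/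
def Interlaces (f g : ℝ[X]) : Prop :=
  IsRealRooted f ∧ IsRealRooted g ∧
    ∃ (m : ℕ) (α : Fin m → ℝ) (β : Fin (m + 1) → ℝ),
      Monotone α ∧ Monotone β ∧
      f.roots = Multiset.map α Finset.univ.val ∧ g.roots = Multiset.map β Finset.univ.val ∧
      ∀ i : Fin m, β i.castSucc ≤ α i ∧ α i ≤ β i.succ

/-- `f` strictly interlaces `g`: it interlaces `g`, and they have no common zero. -/
def StrictlyInterlaces (f g : ℝ[X]) : Prop :=
  Interlaces f g ∧ ∀ x : ℝ, ¬ (f.IsRoot x ∧ g.IsRoot x)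

end StackEulerian

/-! The substitution u = (1 + x)/(1 - x) maps the negative axis onto (-1, 1) and turns the Eulerian
recurrence into differentiation: up to a power of (1 - x)/2, A_{m+1} becomes (u² - 1) h_m(u), where
h_0 = 1 and h_{m+1} = ((u² - 1) h_m)'. Likewise A_{m+3}(t, x)/x becomes L h_m, with L = `legendreOp
t` of order two. It thus suffices to locate the zeros of L h_m in (-1, 1), which is done by sign
changes.

Real-rootedness: h = h_m has m simple zeros in (-1, 1), and those of `tilt 2 h` interlace them. At
the latter, the Laguerre inequality h h'' ≤ h'² and t > -2 force h · L h < 0, so L h alternates in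
sign and has m + 2 zeros.

Interlacing: for t ≤ 3 the same argument works with `tilt 3 h`. The sign of `tilt 3 h` is then known
at each zero c of L h, and it is opposite to that of L h_{m+1}(c) when h(c) ≠ 0
(`RootLadder.legendreOp_tilt_neg`). To see this, `tilt 2 h` is expanded in X h, h and the quotients
h/(X - z_j), and L is applied term by term. If h(c) = 0, a commutation of L with `tilt 2` gives the
sign.

Stack sorting: n - 2 passes sort a permutation of size n exactly when it does not end in its largest
letter followed by its smallest. Counting the exceptions by descents gives x W_{n,n-2} = A_n - x
A_{n-2}, the case t = -1. The PF property follows because the zeros are nonpositive: multiplication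
by X + r with r ≥ 0 preserves total positivity. -/

namespace StackEulerian

open Polynomial

/-! ### Interlacing chains of zeros in `(-1, 1)` -/

/-- A strictly decreasing chain `1 = z 0 > z 1 > ⋯ > z (d + 1) = -1`. -/
structure Ladder (d : ℕ) (z : ℕ → ℝ) : Prop where
  top : z 0 = 1
  bot : z (d + 1) = -1
  step : ∀ i ≤ d, z (i + 1) < z i

/-- The inner points of the chain `z` are the zeros of `p`, which is positive at `1`. -/
structure RootLadder (p : ℝ[X]) (d : ℕ) (z : ℕ → ℝ) : Prop extends Ladder d z where
  degree_le : p.natDegree ≤ d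
  pos : 0 < p.eval 1
  root : ∀ i < d, p.eval (z (i + 1)) = 0

theorem Ladder.lt_of_lt {d : ℕ} {z : ℕ → ℝ} (hz : Ladder d z) {i j : ℕ} (hij : i < j)
    (hj : j ≤ d + 1) : z j < z i := by
  induction j, hij using Nat.le_induction with
  | base => exact hz.step i (by omega)
  | succ j hij ih => exact (hz.step j (by omega)).trans (ih (by omega))

theorem Ladder.lt_one {d : ℕ} {z : ℕ → ℝ} (hz : Ladder d z) {i : ℕ} (hi : i ≤ d) :
    z (i + 1) < 1 := hz.top ▸ hz.lt_of_lt (Nat.succ_pos i) (by omega)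

theorem Ladder.neg_one_lt {d : ℕ} {z : ℕ → ℝ} (hz : Ladder d z) {i : ℕ} (hi : i < d) :
    -1 < z (i + 1) := hz.bot ▸ hz.lt_of_lt (by omega : i + 1 < d + 1) le_rfl

theorem Ladder.sq_lt_one {d : ℕ} {z : ℕ → ℝ} (hz : Ladder d z) {i : ℕ} (hi : i < d) :
    z (i + 1) ^ 2 < 1 := by
  nlinarith [hz.lt_one hi.le, hz.neg_one_lt hi]

/-- The d distinct zeros exhaust the degree, and positivity at 1, to the right of all of them, makes
the constant positive. All sign statements about chains come from this factorization. -/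
theorem RootLadder.factor {p : ℝ[X]} {d : ℕ} {z : ℕ → ℝ} (h : RootLadder p d z) :
    ∃ a : ℝ, 0 < a ∧ p = C a * ∏ i ∈ Finset.range d, (X - C (z (i + 1))) := by
  have hinj : ∀ i ∈ Finset.range d, ∀ j ∈ Finset.range d, z (i + 1) = z (j + 1) → i = j := by
    intro i hi j hj hij
    rw [Finset.mem_range] at hi hj
    rcases lt_trichotomy i j with h1 | h1 | h1
    · exact absurd hij (h.lt_of_lt (by omega : i + 1 < j + 1) (by omega)).ne'
    · exact h1
    · exact absurd hij (h.lt_of_lt (by omega : j + 1 < i + 1) (by omega)).ne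
  have hp0 : p ≠ 0 := by
    rintro rfl
    simpa using h.pos
  have hdvd : ∏ i ∈ Finset.range d, (X - C (z (i + 1))) ∣ p := by
    apply Finset.prod_dvd_of_coprime
    · intro i hi j hj hij
      apply pairwise_coprime_X_sub_C (K := ℝ) (s := fun x : ℝ => x) Function.injective_id
      exact fun h' => hij (hinj i hi j hj h')
    · intro i hi
      exact dvd_iff_isRoot.2 (h.root i (Finset.mem_range.1 hi))
  obtain ⟨q, hq⟩ := hdvd
  have hmon : (∏ i ∈ Finset.range d, (X - C (z (i + 1)))).Monic :=
    monic_prod_of_monic _ _ fun i _ => monic_X_sub_C _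
  have hq0 : q ≠ 0 := by
    rintro rfl
    exact hp0 (by rw [hq, mul_zero])
  have hdeg : q.natDegree = 0 := by
    have h1 := h.degree_le
    rw [hq, hmon.natDegree_mul' hq0, natDegree_prod_of_monic _ _ fun i _ => monic_X_sub_C _] at h1
    simp at h1
    exact h1
  rw [eq_C_of_natDegree_eq_zero hdeg] at hq
  refine ⟨q.coeff 0, ?_, by rw [mul_comm]; exact hq⟩
  have h1 := h.pos
  rw [hq, eval_mul, eval_C, eval_prod] at h1
  refine pos_of_mul_pos_right h1 (Finset.prod_nonneg fun i hi => ?_)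
  rw [Finset.mem_range] at hi
  simpa using (h.lt_one hi.le).le

/-- The sign of a product of linear factors, with `i` zeros above `x`. -/
theorem sign_prod {d i : ℕ} {z : ℕ → ℝ} {x : ℝ} (hi : i ≤ d)
    (h1 : ∀ j < i, x < z (j + 1)) (h2 : ∀ j < d, i ≤ j → z (j + 1) < x) :
    0 < (-1 : ℝ) ^ i * ∏ j ∈ Finset.range d, (x - z (j + 1)) := by
  rw [← Finset.prod_range_mul_prod_Ico _ hi, ← mul_assoc]
  refine mul_pos ?_ (Finset.prod_pos fun j hj => ?_)
  · have : (-1 : ℝ) ^ i = ∏ j ∈ Finset.range i, (-1 : ℝ) := by simp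
    rw [this, ← Finset.prod_mul_distrib]
    refine Finset.prod_pos fun j hj => ?_
    have := h1 j (Finset.mem_range.1 hj)
    linarith
  · rw [Finset.mem_Ico] at hj
    exact sub_pos.2 (h2 j hj.2 hj.1)

theorem RootLadder.sign {p : ℝ[X]} {d i : ℕ} {z : ℕ → ℝ} {x : ℝ} (h : RootLadder p d z)
    (hi : i ≤ d) (h1 : z (i + 1) < x) (h2 : x < z i) : 0 < (-1) ^ i * p.eval x := by
  obtain ⟨a, ha, hp⟩ := h.factor
  have key := sign_prod (z := z) (x := x) hi
    (fun j hj => h2.trans_le <| by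
      rcases (show j + 1 ≤ i from hj).eq_or_lt with h3 | h3
      · rw [h3]
      · exact (h.lt_of_lt h3 (by omega)).le)
    (fun j hj hij => lt_of_le_of_lt (by
      rcases hij.eq_or_lt with h3 | h3
      · rw [h3]
      · exact (h.lt_of_lt (by omega : i + 1 < j + 1) (by omega)).le) h1)
  rw [hp, eval_mul, eval_C, eval_prod]
  simp only [eval_sub, eval_X, eval_C]
  have := mul_pos ha key
  linarith

theorem RootLadder.sign_neg_one {p : ℝ[X]} {d : ℕ} {z : ℕ → ℝ} (h : RootLadder p d z) :
    0 < (-1) ^ d * p.eval (-1) := by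
  obtain ⟨a, ha, hp⟩ := h.factor
  have key := sign_prod (z := z) (x := -1) le_rfl (fun j hj => h.neg_one_lt hj)
    (fun j hj hij => absurd hj (by omega))
  rw [hp, eval_mul, eval_C, eval_prod]
  simp only [eval_sub, eval_X, eval_C]
  have := mul_pos ha key
  linarith

theorem RootLadder.sign_derivative {p : ℝ[X]} {d i : ℕ} {z : ℕ → ℝ} (h : RootLadder p d z)
    (hi : i < d) : 0 < (-1) ^ i * p.derivative.eval (z (i + 1)) := by
  obtain ⟨a, ha, hp⟩ := h.factor
  have e : p = (X - C (z (i + 1))) * (C a * ((∏ j ∈ Finset.range i, (X - C (z (j + 1)))) *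
      ∏ j ∈ Finset.Ico (i + 1) d, (X - C (z (j + 1))))) := by
    rw [hp, ← Finset.prod_range_mul_prod_Ico _ (show i + 1 ≤ d from hi), Finset.prod_range_succ]
    ring
  rw [e, derivative_mul]
  simp only [derivative_sub, derivative_X, derivative_C, eval_add, eval_mul, eval_sub, eval_X,
    eval_C, sub_self, zero_mul, add_zero, sub_zero, one_mul, eval_prod]
  have h1 := sign_prod (z := z) (x := z (i + 1)) (le_refl i)
    (fun j hj => h.lt_of_lt (by omega : j + 1 < i + 1) (by omega))
    (fun j hj hij => absurd hj (by omega))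
  have h2 : 0 < ∏ j ∈ Finset.Ico (i + 1) d, (z (i + 1) - z (j + 1)) := by
    refine Finset.prod_pos fun j hj => sub_pos.2 ?_
    rw [Finset.mem_Ico] at hj
    exact h.lt_of_lt (by omega) (by omega)
  have := mul_pos ha (mul_pos h1 h2)
  linarith

/-- A polynomial of degree at most `d + 1` whose sign alternates along a chain has all its zeros
real, and they interlace the chain. -/
theorem Ladder.exists_rootLadder {q : ℝ[X]} {d : ℕ} {z : ℕ → ℝ} (hz : Ladder d z)
    (hdeg : q.natDegree ≤ d + 1) (hq : ∀ i ≤ d + 1, 0 < (-1) ^ i * q.eval (z i)) :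
    ∃ y, RootLadder q (d + 1) y ∧ ∀ i ≤ d, z (i + 1) < y (i + 1) ∧ y (i + 1) < z i := by
  have key : ∀ i, ∃ x, i ≤ d → q.eval x = 0 ∧ z (i + 1) < x ∧ x < z i := by
    intro i
    by_cases hi : i ≤ d
    · have h1 := hq i (by omega)
      have h2 := hq (i + 1) (by omega)
      have hlt := hz.step i hi
      rw [pow_succ] at h2
      have hcont : ContinuousOn (fun x => (-1 : ℝ) ^ i * q.eval x) (Set.Icc (z (i + 1)) (z i)) := by
        fun_prop
      obtain ⟨x, hx, hx0⟩ := intermediate_value_Ioo hlt.le hcont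
        (show (0 : ℝ) ∈ Set.Ioo _ _ from ⟨by linarith, h1⟩)
      refine ⟨x, fun _ => ⟨?_, hx.1, hx.2⟩⟩
      simpa using hx0
    · exact ⟨0, fun h => absurd h hi⟩
  choose x hx using key
  -- The zero found between `z (i + 1)` and `z i` becomes `y (i + 1)`; the ends are padded with 1
  -- and -1.
  let y : ℕ → ℝ := fun j => if j = 0 then 1 else if j ≤ d + 1 then x (j - 1) else -1
  have hy : ∀ i ≤ d, y (i + 1) = x i := by
    intro i hi
    simp [y, hi]
  have hy0 : y 0 = 1 := by simp [y]
  have hyd : y (d + 1 + 1) = -1 := by simp [y]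
  refine ⟨y, ⟨⟨hy0, hyd, ?_⟩, hdeg, ?_, ?_⟩, ?_⟩
  · rintro (_ | i) hi
    · rw [hy 0 (by omega), hy0, ← hz.top]
      exact (hx 0 (by omega)).2.2
    · rw [hy i (by omega)]
      rcases hi.eq_or_lt with h1 | h1
      · rw [h1, hyd, ← hz.bot, show d = i by omega]
        exact (hx i (by omega)).2.1
      · rw [hy (i + 1) (by omega)]
        exact (hx (i + 1) (by omega)).2.2.trans (hx i (by omega)).2.1
  · simpa [hz.top] using hq 0 (by omega)
  · intro i hi
    rw [hy i (by omega)]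
    exact (hx i (by omega)).1
  · intro i hi
    rw [hy i hi]
    exact (hx i hi).2

/-! ### First and second order operators -/

/-- The operator `h ↦ (X² - 1) h' + c X h`. -/
noncomputable def tilt (c : ℝ) (h : ℝ[X]) : ℝ[X] := (X ^ 2 - 1) * derivative h + C c * X * h

/-- The operator
`h ↦ (X² - 1)² h'' + 6 X (X² - 1) h' + ((6 + t) X² - (2 + t)) h`. -/
noncomputable def legendreOp (t : ℝ) (h : ℝ[X]) : ℝ[X] :=
  (X ^ 2 - 1) ^ 2 * derivative (derivative h) + 6 * X * (X ^ 2 - 1) * derivative h +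
    (C (6 + t) * X ^ 2 - C (2 + t)) * h

/-- The polynomials `h` such that `(u² - 1) h(u)` is a multiple of `A_{m+1}(x) / (1 - x) ^ (m + 2)`
at `u = (1 + x) / (1 - x)`. -/
noncomputable def eulerianCore : ℕ → ℝ[X]
  | 0 => 1
  | m + 1 => tilt 2 (eulerianCore m)

theorem natDegree_X_sq_sub_one_mul_derivative_le {h : ℝ[X]} {d : ℕ} (hd : h.natDegree ≤ d) :
    ((X ^ 2 - 1) * derivative h).natDegree ≤ d + 1 := by
  rcases Nat.eq_zero_or_pos h.natDegree with h0 | h0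
  · rw [eq_C_of_natDegree_eq_zero h0]
    simp
  · have h1 := natDegree_derivative_lt h0.ne'
    have h2 : ((X ^ 2 - 1 : ℝ[X])).natDegree ≤ 2 := by compute_degree
    have h3 := natDegree_mul_le (p := (X ^ 2 - 1 : ℝ[X])) (q := derivative h)
    omega

theorem natDegree_tilt_le {h : ℝ[X]} {d : ℕ} (hd : h.natDegree ≤ d) (c : ℝ) :
    (tilt c h).natDegree ≤ d + 1 := by
  refine natDegree_add_le_of_degree_le (natDegree_X_sq_sub_one_mul_derivative_le hd) ?_
  have h2 : ((C c * X : ℝ[X])).natDegree ≤ 1 := by compute_degree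
  have h3 := natDegree_mul_le (p := (C c * X : ℝ[X])) (q := h)
  omega

/-- Since `tilt 2` is h ↦ ((X² - 1) h)', this identifies the operator with the image of A_n + t x
A_{n-2} under the change of variable. -/
theorem legendreOp_eq_tilt_tilt (t : ℝ) (h : ℝ[X]) :
    legendreOp t h = tilt 2 (tilt 2 h) + C t * (X ^ 2 - 1) * h := by
  simp only [legendreOp, tilt, derivative_add, derivative_mul, derivative_sub, derivative_X_pow,
    derivative_one, derivative_C, derivative_X, C_add]
  simp only [Nat.cast_ofNat, map_ofNat]
  ring

theorem natDegree_legendreOp_le {h : ℝ[X]} {d : ℕ} (hd : h.natDegree ≤ d) (t : ℝ) :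
    (legendreOp t h).natDegree ≤ d + 2 := by
  rw [legendreOp_eq_tilt_tilt]
  refine natDegree_add_le_of_degree_le (natDegree_tilt_le (natDegree_tilt_le hd 2) 2) ?_
  have h2 : ((C t * (X ^ 2 - 1) : ℝ[X])).natDegree ≤ 2 := by compute_degree
  have h3 := natDegree_mul_le (p := (C t * (X ^ 2 - 1) : ℝ[X])) (q := h)
  omega

theorem eval_tilt (c x : ℝ) (h : ℝ[X]) :
    (tilt c h).eval x = (x ^ 2 - 1) * (derivative h).eval x + c * x * h.eval x := by
  simp [tilt]

theorem eval_legendreOp (t x : ℝ) (h : ℝ[X]) :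
    (legendreOp t h).eval x = (x ^ 2 - 1) ^ 2 * (derivative (derivative h)).eval x +
      6 * x * (x ^ 2 - 1) * (derivative h).eval x +
      ((6 + t) * x ^ 2 - (2 + t)) * h.eval x := by
  simp [legendreOp]

/-- The zeros of `tilt c h` interlace those of `h`. -/
theorem RootLadder.tilt {h : ℝ[X]} {d : ℕ} {z : ℕ → ℝ} (hz : RootLadder h d z) {c : ℝ}
    (hc : 0 < c) : ∃ y, RootLadder (tilt c h) (d + 1) y ∧
      ∀ i ≤ d, z (i + 1) < y (i + 1) ∧ y (i + 1) < z i := by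
  refine hz.toLadder.exists_rootLadder (natDegree_tilt_le hz.degree_le c) ?_
  rintro (_ | i) hi
  · rw [hz.top, eval_tilt]
    have := mul_pos hc hz.pos
    simpa using this
  · rcases hi.eq_or_lt with h1 | h1
    · obtain rfl : i = d := by omega
      rw [hz.bot, eval_tilt]
      have := mul_pos hc hz.sign_neg_one
      rw [pow_succ]
      linarith
    · have hi' : i < d := by omega
      rw [eval_tilt, hz.root i hi', pow_succ]
      have := mul_pos (sub_pos.2 (hz.sq_lt_one hi')) (hz.sign_derivative hi')
      linarith

theorem exists_rootLadder_eulerianCore (m : ℕ) : ∃ z, RootLadder (eulerianCore m) m z := by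
  induction m with
  | zero =>
    -- The chain 1, -1 without inner points.
    refine ⟨fun i => 1 - 2 * i, ⟨by simp, by norm_num, fun i _ => by push_cast; linarith⟩, ?_, ?_,
      fun i hi => absurd hi (by omega)⟩
    · simp [eulerianCore]
    · simp [eulerianCore]
  | succ m ih =>
    obtain ⟨z, hz⟩ := ih
    obtain ⟨y, hy, -⟩ := hz.tilt (c := 2) two_pos
    exact ⟨y, hy⟩

/-- The quotients of a product of linear factors by one of the factors. -/
theorem exists_quotients_prod (d : ℕ) (r : ℕ → ℝ) : ∃ q : ℕ → ℝ[X],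
    (∀ j < d, ∏ i ∈ Finset.range d, (X - C (r i)) = (X - C (r j)) * q j) ∧
    derivative (∏ i ∈ Finset.range d, (X - C (r i))) = ∑ j ∈ Finset.range d, q j ∧
    derivative (∏ i ∈ Finset.range d, (X - C (r i))) ^ 2 -
      (∏ i ∈ Finset.range d, (X - C (r i))) *
        derivative (derivative (∏ i ∈ Finset.range d, (X - C (r i)))) =
      ∑ j ∈ Finset.range d, q j ^ 2 := by
  induction d with
  | zero => exact ⟨fun _ => 0, by simp⟩
  | succ d ih =>
    obtain ⟨q, h1, h2, h3⟩ := ih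
    set P := ∏ i ∈ Finset.range d, (X - C (r i)) with hP
    have e1 : ∀ j < d, (if j < d then (X - C (r d)) * q j else P) = (X - C (r d)) * q j :=
      fun j hj => if_pos hj
    refine ⟨fun j => if j < d then (X - C (r d)) * q j else P, ?_, ?_, ?_⟩
    · intro j hj
      rw [Finset.prod_range_succ, ← hP]
      rcases (Nat.lt_succ_iff.1 hj).eq_or_lt with rfl | hj'
      · simp [mul_comm]
      · beta_reduce
        rw [e1 j hj', h1 j hj']
        ring
    · rw [Finset.prod_range_succ, ← hP, Finset.sum_range_succ,
        Finset.sum_congr rfl fun j hj => e1 j (Finset.mem_range.1 hj), ← Finset.mul_sum, ← h2]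
      simp
      ring
    · have e2 : ∑ j ∈ Finset.range d, (if j < d then (X - C (r d)) * q j else P) ^ 2 =
          (X - C (r d)) ^ 2 * ∑ j ∈ Finset.range d, q j ^ 2 := by
        rw [Finset.mul_sum]
        exact Finset.sum_congr rfl fun j hj => by rw [e1 j (Finset.mem_range.1 hj), mul_pow]
      rw [Finset.prod_range_succ, ← hP, Finset.sum_range_succ, e2, ← h3]
      simp
      ring

/-- The quotients `q j` of a polynomial with zeros `z 1, …, z d` by its linear factors. -/
theorem RootLadder.exists_quotients {h : ℝ[X]} {d : ℕ} {z : ℕ → ℝ} (hz : RootLadder h d z) :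
    ∃ q : ℕ → ℝ[X], (∀ j < d, h = (X - C (z (j + 1))) * q j) ∧
      derivative h = ∑ j ∈ Finset.range d, q j ∧
      derivative h ^ 2 - h * derivative (derivative h) = ∑ j ∈ Finset.range d, q j ^ 2 := by
  obtain ⟨a, -, hp⟩ := hz.factor
  obtain ⟨q, h1, h2, h3⟩ := exists_quotients_prod d fun i => z (i + 1)
  refine ⟨fun j => C a * q j, ?_, ?_, ?_⟩
  · intro j hj
    rw [hp, h1 j hj]
    ring
  · rw [hp, derivative_C_mul, h2, Finset.mul_sum]
  · simp only [mul_pow]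
    rw [← Finset.mul_sum, ← h3, hp, derivative_C_mul, derivative_C_mul]
    ring

/-- The difference of the two sides is the sum of the squares of the quotients h/(X - z_j). -/
theorem RootLadder.laguerre {h : ℝ[X]} {d : ℕ} {z : ℕ → ℝ} (hz : RootLadder h d z) (x : ℝ) :
    h.eval x * (derivative (derivative h)).eval x ≤ (derivative h).eval x ^ 2 := by
  obtain ⟨q, -, -, h3⟩ := hz.exists_quotients
  have := congrArg (eval x) h3
  simp only [eval_sub, eval_pow, eval_mul, eval_finsetSum] at this
  have h0 : 0 ≤ ∑ j ∈ Finset.range d, (q j).eval x ^ 2 :=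
    Finset.sum_nonneg fun _ _ => sq_nonneg _
  linarith

/-- If `legendreOp t h` and `h` have opposite signs at the zeros of `tilt c h`, then the zeros of
`legendreOp t h` interlace those of `tilt c h`. -/
theorem RootLadder.exists_rootLadder_legendreOp {h : ℝ[X]} {d : ℕ} {z y : ℕ → ℝ} {c t : ℝ}
    (hz : RootLadder h d z) (hy : RootLadder (StackEulerian.tilt c h) (d + 1) y)
    (hyz : ∀ i ≤ d, z (i + 1) < y (i + 1) ∧ y (i + 1) < z i)
    (hop : ∀ x : ℝ, x ^ 2 < 1 → h.eval x ≠ 0 → (StackEulerian.tilt c h).eval x = 0 →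
      h.eval x * (legendreOp t h).eval x < 0) :
    ∃ w, RootLadder (legendreOp t h) (d + 2) w ∧
      ∀ i ≤ d + 1, y (i + 1) < w (i + 1) ∧ w (i + 1) < y i := by
  refine hy.toLadder.exists_rootLadder (natDegree_legendreOp_le hz.degree_le t) ?_
  rintro (_ | i) hi
  · rw [hy.top, eval_legendreOp]
    have := hz.pos
    norm_num
    linarith
  · rcases hi.eq_or_lt with h1 | h1
    · obtain rfl : i = d + 1 := by omega
      rw [hy.bot, eval_legendreOp]
      have := hz.sign_neg_one
      rw [pow_succ, pow_succ]
      norm_num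
      linarith
    · have hi' : i ≤ d := by omega
      have hs := hz.sign hi' (hyz i hi').1 (hyz i hi').2
      have h0 : h.eval (y (i + 1)) ≠ 0 := by
        intro h0
        simp [h0] at hs
      have h2 := hop _ (hy.sq_lt_one (by omega)) h0 (hy.root i (by omega))
      rw [pow_succ]
      rcases neg_one_pow_eq_or ℝ i with e | e <;> rw [e] at hs ⊢ <;> nlinarith

/-- Eliminating h' through (x² - 1) h' = -2x h and bounding h h'' by h'² gives h · L h ≤ -((2 - t)
x² + 2 + t) h², and the bracket equals (2 + t)(1 - x²) + 4x². -/
theorem RootLadder.legendreOp_neg_at_tilt_two {h : ℝ[X]} {d : ℕ} {z : ℕ → ℝ} {t x : ℝ}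
    (hz : RootLadder h d z) (ht : -2 < t) (hx : x ^ 2 < 1) (h0 : h.eval x ≠ 0)
    (hk : (StackEulerian.tilt 2 h).eval x = 0) : h.eval x * (legendreOp t h).eval x < 0 := by
  have hl := hz.laguerre x
  rw [eval_tilt] at hk
  rw [eval_legendreOp]
  generalize h.eval x = a at *
  generalize (derivative h).eval x = b at *
  generalize (derivative (derivative h)).eval x = e at *
  have hA : (x ^ 2 - 1) ^ 2 * (a * e) ≤ (x ^ 2 - 1) ^ 2 * b ^ 2 :=
    mul_le_mul_of_nonneg_left hl (sq_nonneg _)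
  have hb : (x ^ 2 - 1) * b = - (2 * x * a) := by linarith
  have h1 : (x ^ 2 - 1) ^ 2 * b ^ 2 = 4 * x ^ 2 * a ^ 2 := by
    rw [← mul_pow, hb]; ring
  have h2 : 6 * x * (x ^ 2 - 1) * b * a = - (12 * x ^ 2 * a ^ 2) := by
    rw [show 6 * x * (x ^ 2 - 1) * b * a = 6 * x * a * ((x ^ 2 - 1) * b) by ring, hb]; ring
  have h3 : 0 < (2 + t) * (1 - x ^ 2) * a ^ 2 := by
    have := sq_pos_of_ne_zero h0
    have : 0 < 1 - x ^ 2 := by linarith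
    have : 0 < 2 + t := by linarith
    positivity
  nlinarith

/-- Now (x² - 1) h' = -3x h, and the bound becomes -((3 - t) x² + 2 + t) h²; this is where t ≤ 3
enters. -/
theorem RootLadder.legendreOp_neg_at_tilt_three {h : ℝ[X]} {d : ℕ} {z : ℕ → ℝ} {t x : ℝ}
    (hz : RootLadder h d z) (ht : -2 < t) (ht' : t ≤ 3) (h0 : h.eval x ≠ 0)
    (hk : (StackEulerian.tilt 3 h).eval x = 0) : h.eval x * (legendreOp t h).eval x < 0 := by
  have hl := hz.laguerre x
  rw [eval_tilt] at hk
  rw [eval_legendreOp]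
  generalize h.eval x = a at *
  generalize (derivative h).eval x = b at *
  generalize (derivative (derivative h)).eval x = e at *
  have hA : (x ^ 2 - 1) ^ 2 * (a * e) ≤ (x ^ 2 - 1) ^ 2 * b ^ 2 :=
    mul_le_mul_of_nonneg_left hl (sq_nonneg _)
  have hb : (x ^ 2 - 1) * b = - (3 * x * a) := by linarith
  have h1 : (x ^ 2 - 1) ^ 2 * b ^ 2 = 9 * x ^ 2 * a ^ 2 := by
    rw [← mul_pow, hb]; ring
  have h2 : 6 * x * (x ^ 2 - 1) * b * a = - (18 * x ^ 2 * a ^ 2) := by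
    rw [show 6 * x * (x ^ 2 - 1) * b * a = 6 * x * a * ((x ^ 2 - 1) * b) by ring, hb]; ring
  have h3 : 0 < ((3 - t) * x ^ 2 + (2 + t)) * a ^ 2 := by
    have := sq_pos_of_ne_zero h0
    have : 0 ≤ 3 - t := by linarith
    have : 0 < 2 + t := by linarith
    positivity
  nlinarith

/-- At a zero `c` of `legendreOp t h` in `(-1, 1)` that is not a zero of `h`, the polynomials
`legendreOp t (tilt 2 h)` and `tilt 3 h` have opposite signs. -/
theorem RootLadder.legendreOp_tilt_neg {h : ℝ[X]} {d : ℕ} {z : ℕ → ℝ} {t c : ℝ}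
    (hz : RootLadder h d z) (ht : -2 < t) (ht' : t ≤ 3) (hc : c ^ 2 < 1) (h0 : h.eval c ≠ 0)
    (hop : (legendreOp t h).eval c = 0) :
    (StackEulerian.tilt 3 h).eval c *
      (legendreOp t (StackEulerian.tilt 2 h)).eval c < 0 := by
  obtain ⟨q, h1, h2, h3⟩ := hz.exists_quotients
  -- Sum over j of (X² - 1) q_j = (X + z_j) h - (1 - z_j²) q_j, using h' = ∑ q_j.
  have hkey : StackEulerian.tilt 2 h = (C (d + 2 : ℝ) * X) * h +
      C (∑ j ∈ Finset.range d, z (j + 1)) * h -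
      ∑ j ∈ Finset.range d, C (1 - z (j + 1) ^ 2) * q j := by
    have e : (X ^ 2 - 1) * ∑ j ∈ Finset.range d, q j =
        ∑ j ∈ Finset.range d, (X * h + C (z (j + 1)) * h - C (1 - z (j + 1) ^ 2) * q j) := by
      rw [Finset.mul_sum]
      refine Finset.sum_congr rfl fun j hj => ?_
      have := h1 j (Finset.mem_range.1 hj)
      simp only [C_sub, C_1, C_pow]
      linear_combination (-X - C (z (j + 1))) * this
    rw [StackEulerian.tilt, h2, e, Finset.sum_sub_distrib, Finset.sum_add_distrib,
      Finset.sum_const, ← Finset.sum_mul, ← map_sum, Finset.card_range, nsmul_eq_mul, C_add,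
      C_eq_natCast]
    ring
  have hlin : legendreOp t (StackEulerian.tilt 2 h) =
      legendreOp t ((C (d + 2 : ℝ) * X) * h) +
      C (∑ j ∈ Finset.range d, z (j + 1)) * legendreOp t h -
      ∑ j ∈ Finset.range d, C (1 - z (j + 1) ^ 2) * legendreOp t (q j) := by
    have e : ∑ j ∈ Finset.range d, C (1 - z (j + 1) ^ 2) * legendreOp t (q j) =
        legendreOp t (∑ j ∈ Finset.range d, C (1 - z (j + 1) ^ 2) * q j) := by
      simp only [legendreOp, derivative_sum, derivative_C_mul, Finset.mul_sum,
        ← Finset.sum_add_distrib]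
      exact Finset.sum_congr rfl fun j _ => by ring
    rw [hkey, e]
    simp only [legendreOp, derivative_sub, derivative_add, derivative_C_mul]
    ring
  set A := (c ^ 2 - 1) ^ 2 with hA
  have hA0 : 0 < A := by
    have : c ^ 2 - 1 ≠ 0 := by linarith
    positivity
  -- V completes the square in the second-order equation at c; it is also half the value of L(X h)
  -- there. The claim amounts to V · L(`tilt 2 h`)(c) > 0, because c² - 1 < 0.
  set V := (c ^ 2 - 1) * (StackEulerian.tilt 3 h).eval c with hV
  have hV' : V = A * (derivative h).eval c + 3 * c * (c ^ 2 - 1) * h.eval c := by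
    rw [hV, hA, eval_tilt]; ring
  have hVsq : V ^ 2 = A ^ 2 * ∑ j ∈ Finset.range d, (q j).eval c ^ 2 +
      A * ((3 - t) * c ^ 2 + (2 + t)) * h.eval c ^ 2 := by
    have e := congrArg (eval c) h3
    simp only [eval_sub, eval_pow, eval_mul, eval_finsetSum] at e
    rw [← e, hV', hA]
    rw [eval_legendreOp] at hop
    linear_combination ((c ^ 2 - 1) ^ 2 * h.eval c) * hop
  have hpos : 0 < A * ((3 - t) * c ^ 2 + (2 + t)) * h.eval c ^ 2 := by
    have : 0 ≤ 3 - t := by linarith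
    have : 0 < 2 + t := by linarith
    positivity
  -- The formula for V² gives (A q_j)² < V², and 2 (A q_j) V ≤ (A q_j)² + V².
  have hVq : ∀ j < d, A * (q j).eval c * V < V ^ 2 := by
    intro j hj
    have h5 : (q j).eval c ^ 2 ≤ ∑ j ∈ Finset.range d, (q j).eval c ^ 2 :=
      Finset.single_le_sum (f := fun j => (q j).eval c ^ 2) (fun _ _ => sq_nonneg _)
        (Finset.mem_range.2 hj)
    have h6 := mul_le_mul_of_nonneg_left h5 (sq_nonneg A)
    nlinarith [sq_nonneg (A * (q j).eval c - V)]
  have hV0 : 0 < V ^ 2 := by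
    rw [hVsq]
    have : 0 ≤ A ^ 2 * ∑ j ∈ Finset.range d, (q j).eval c ^ 2 :=
      mul_nonneg (sq_nonneg _) (Finset.sum_nonneg fun _ _ => sq_nonneg _)
    linarith
  have hq : ∀ j < d, (legendreOp t (q j)).eval c * V < 0 := by
    intro j hj
    have e0 := congrArg (eval c) (h1 j hj)
    have e1 := congrArg (fun p => eval c (derivative p)) (h1 j hj)
    have e2 := congrArg (fun p => eval c (derivative (derivative p))) (h1 j hj)
    simp at e0 e1 e2
    have hne : c - z (j + 1) ≠ 0 := by
      intro h'
      rw [h', zero_mul] at e0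
      exact h0 e0
    -- Expand L h = 0 at c with h = (X - z_j) q_j, then multiply by c - z_j to bring back h and h'.
    have e3 : (c - z (j + 1)) ^ 2 * (legendreOp t (q j)).eval c = -2 * V + 2 * A * (q j).eval c := by
      rw [eval_legendreOp] at hop ⊢
      rw [hV', hA]
      rw [e0, e1, e2] at hop
      rw [e0, e1]
      linear_combination (c - z (j + 1)) * hop
    have h7 : 0 < (c - z (j + 1)) ^ 2 := by positivity
    have h8 : (c - z (j + 1)) ^ 2 * ((legendreOp t (q j)).eval c * V) < 0 := by
      rw [← mul_assoc, e3]
      linarith [hVq j hj]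
    exact (pos_iff_neg_of_mul_neg h8).1 h7
  have hX : (legendreOp t ((C (d + 2 : ℝ) * X) * h)).eval c = 2 * (d + 2) * V := by
    have : legendreOp t ((C (d + 2 : ℝ) * X) * h) = C (d + 2 : ℝ) * (X * legendreOp t h +
        2 * (X ^ 2 - 1) ^ 2 * derivative h + 6 * X * (X ^ 2 - 1) * h) := by
      simp only [legendreOp, derivative_C, derivative_zero, derivative_mul,
        derivative_add, derivative_X, derivative_one]
      ring
    rw [this, hV', hA]
    simp [hop]
    ring
  have hfin : 0 < V * (legendreOp t (StackEulerian.tilt 2 h)).eval c := by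
    rw [hlin]
    simp only [eval_sub, eval_add, eval_mul, eval_C, eval_finsetSum]
    rw [hop, hX, mul_zero, add_zero, mul_sub, Finset.mul_sum]
    have h9 : ∑ j ∈ Finset.range d,
        V * ((1 - z (j + 1) ^ 2) * (legendreOp t (q j)).eval c) ≤ 0 := by
      refine Finset.sum_nonpos fun j hj => ?_
      have hj' := Finset.mem_range.1 hj
      have := mul_neg_of_pos_of_neg (sub_pos.2 (hz.sq_lt_one hj')) (hq j hj')
      linarith
    have h10 : 0 < (2 * (d + 2) : ℝ) * V ^ 2 := by positivity
    linarith
  have h11 : (c ^ 2 - 1) * ((StackEulerian.tilt 3 h).eval c *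
      (legendreOp t (StackEulerian.tilt 2 h)).eval c) > 0 := by
    rw [← mul_assoc]; exact hfin
  exact (neg_iff_neg_of_mul_pos h11).1 (by linarith)

/-- L and `tilt 2` commute up to a multiple of h, so only the derivative of L h matters at a common
zero of h and L h. -/
theorem eval_legendreOp_tilt_of_eval_eq_zero {h : ℝ[X]} {c : ℝ} (t : ℝ) (h0 : h.eval c = 0) :
    (legendreOp t (tilt 2 h)).eval c = (c ^ 2 - 1) * (derivative (legendreOp t h)).eval c +
      2 * c * (legendreOp t h).eval c := by
  have : legendreOp t (tilt 2 h) = tilt 2 (legendreOp t h) - C (2 * t) * X * (X ^ 2 - 1) * h := by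
    simp only [legendreOp, tilt, derivative_add, derivative_mul, derivative_sub, derivative_one,
      derivative_C, derivative_X, C_add, C_mul, sq, derivative_ofNat, derivative_zero, map_ofNat]
    ring
  rw [this, eval_sub, eval_tilt]
  simp [h0]

/-! ### Chains of zeros for the transformed polynomials A_n(t, x)/x -/

theorem exists_rootLadder_legendreOp (t : ℝ) (ht : -2 < t) (m : ℕ) :
    ∃ w, RootLadder (legendreOp t (eulerianCore m)) (m + 2) w := by
  obtain ⟨z, hz⟩ := exists_rootLadder_eulerianCore m
  obtain ⟨y, hy, hyz⟩ := hz.tilt (c := 2) two_pos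
  obtain ⟨w, hw, -⟩ := hz.exists_rootLadder_legendreOp (t := t) hy hyz
    fun x => hz.legendreOp_neg_at_tilt_two ht
  exact ⟨w, hw⟩

theorem exists_interlacing_rootLadder_legendreOp (t : ℝ) (ht : -2 < t) (ht' : t ≤ 3) (m : ℕ) :
    ∃ w s, RootLadder (legendreOp t (eulerianCore m)) (m + 2) w ∧
      RootLadder (legendreOp t (eulerianCore (m + 1))) (m + 3) s ∧
      ∀ i ≤ m + 2, w (i + 1) < s (i + 1) ∧ s (i + 1) < w i := by
  obtain ⟨z, hz⟩ := exists_rootLadder_eulerianCore m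
  obtain ⟨z', hz'⟩ := exists_rootLadder_eulerianCore (m + 1)
  obtain ⟨y, hy, hyz⟩ := hz.tilt (c := 3) three_pos
  obtain ⟨w, hw, hwy⟩ := hz.exists_rootLadder_legendreOp (t := t) hy hyz
    fun x _ => hz.legendreOp_neg_at_tilt_three ht ht'
  obtain ⟨s, hs, hsw⟩ := hw.toLadder.exists_rootLadder
    (q := legendreOp t (eulerianCore (m + 1))) (natDegree_legendreOp_le hz'.degree_le t) (by
    rintro (_ | i) hi
    · rw [hw.top, eval_legendreOp]
      have := hz'.pos
      norm_num
      linarith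
    · rcases hi.eq_or_lt with h1 | h1
      · obtain rfl : i = m + 2 := by omega
        rw [hw.bot, eval_legendreOp]
        have := hz'.sign_neg_one
        rw [pow_succ, pow_succ]
        norm_num
        linarith
      · have hi' : i ≤ m + 1 := by omega
        have hsq := hw.sq_lt_one (show i < m + 2 by omega)
        have hroot := hw.root i (by omega)
        -- If h vanishes at the zero of L h, the sign comes from the derivative of L h; otherwise
        -- from `tilt 3 h`, whose zeros interlace those of L h.
        by_cases h0 : (eulerianCore m).eval (w (i + 1)) = 0
        · have h2 := hw.sign_derivative (show i < m + 2 by omega)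
          rw [eulerianCore, eval_legendreOp_tilt_of_eval_eq_zero t h0, hroot, pow_succ]
          have := mul_pos (sub_pos.2 hsq) h2
          linarith
        · have h2 := hz.legendreOp_tilt_neg ht ht' hsq h0 hroot
          have h3 := hy.sign hi' (hwy i hi').1 (hwy i hi').2
          rw [eulerianCore, pow_succ]
          rcases neg_one_pow_eq_or ℝ i with e | e <;> rw [e] at h3 ⊢ <;> nlinarith)
  exact ⟨w, s, hw, hs, hsw⟩

/-! ### Permutations as lists -/

/-- The number of descents of a word. -/
def listDes : List ℕ → ℕ
  | [] => 0
  | [_] => 0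
  | a :: b :: l => (if b < a then 1 else 0) + listDes (b :: l)

theorem listDes_cons_cons (a b : ℕ) (l : List ℕ) :
    listDes (a :: b :: l) = (if b < a then 1 else 0) + listDes (b :: l) := rfl

/-- The one-line notations of the permutations of `0, …, n - 1`. -/
def permWords (n : ℕ) : Finset (List ℕ) := (List.range n).permutations'.toFinset

theorem mem_permWords {n : ℕ} {l : List ℕ} : l ∈ permWords n ↔ l.Perm (List.range n) := by
  simp [permWords]

theorem nodup_permutations'_range (n : ℕ) : (List.range n).permutations'.Nodup :=
  (List.permutations_perm_permutations' _).nodup_iff.1 (List.nodup_permutations _ List.nodup_range)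

/-- The one-line notation of a permutation. -/
def word {n : ℕ} (π : Equiv.Perm (Fin n)) : List ℕ := List.ofFn fun i : Fin n => (π i : ℕ)

theorem word_injective (n : ℕ) : Function.Injective (word : Equiv.Perm (Fin n) → List ℕ) := by
  intro π σ h
  ext i
  exact congrFun (List.ofFn_injective h) i

theorem word_mem_permWords {n : ℕ} (π : Equiv.Perm (Fin n)) : word π ∈ permWords n := by
  rw [mem_permWords]
  have h := (Equiv.Perm.ofFn_comp_perm π fun i : Fin n => (i : ℕ))
  have e : List.ofFn (fun i : Fin n => (i : ℕ)) = List.range n := by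
    apply List.ext_getElem <;> simp
  rwa [e] at h

theorem sum_word {n : ℕ} {M : Type*} [AddCommMonoid M] (φ : List ℕ → M) :
    ∑ π : Equiv.Perm (Fin n), φ (word π) = ∑ l ∈ permWords n, φ l := by
  have h : Finset.univ.image (word : Equiv.Perm (Fin n) → List ℕ) = permWords n := by
    refine Finset.eq_of_subset_of_card_le ?_ ?_
    · intro l hl
      obtain ⟨π, -, rfl⟩ := Finset.mem_image.1 hl
      exact word_mem_permWords π
    · rw [Finset.card_image_of_injective _ (word_injective n), Finset.card_univ,
        Fintype.card_perm, Fintype.card_fin, permWords]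
      refine (List.toFinset_card_le _).trans ?_
      rw [← (List.permutations_perm_permutations' _).length_eq, List.length_permutations,
        List.length_range]
  rw [← h, Finset.sum_image fun _ _ _ _ h => word_injective n h]

theorem card_descents {n : ℕ} (f : Fin n → ℕ) :
    (Finset.univ.filter fun i : Fin n => ∃ h : i.val + 1 < n, f ⟨i.val + 1, h⟩ < f i).card =
      listDes (List.ofFn f) := by
  induction n with
  | zero => simp [listDes]
  | succ n ih =>
    cases n with
    | zero =>
      rw [Finset.filter_false_of_mem fun i _ ⟨h, _⟩ => by omega]
      simp [listDes]
    | succ n =>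
      rw [Fin.card_filter_univ_succ]
      have h1 := ih fun i => f i.succ
      have h2 : (Finset.univ.filter fun i : Fin (n + 1) =>
          ∃ h : i.succ.val + 1 < n + 1 + 1, f ⟨i.succ.val + 1, h⟩ < f i.succ).card =
          (Finset.univ.filter fun i : Fin (n + 1) =>
          ∃ h : i.val + 1 < n + 1, f (Fin.succ ⟨i.val + 1, h⟩) < f i.succ).card := by
        congr 1
        ext i
        simp [Fin.succ]
      rw [h2, h1, List.ofFn_succ (f := f), List.ofFn_succ (f := fun i => f i.succ),
        listDes_cons_cons]
      have h3 : (∃ h : (0 : Fin (n + 1 + 1)).val + 1 < n + 1 + 1,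
          f ⟨(0 : Fin (n + 1 + 1)).val + 1, h⟩ < f 0) ↔ f (Fin.succ 0) < f 0 := by
        simp [Fin.succ]
      simp only [h3]
      split_ifs <;> ring

theorem des_eq_listDes {n : ℕ} (π : Equiv.Perm (Fin n)) : des π = listDes (word π) := by
  rw [word, ← card_descents]
  rfl

/-! ### The recurrence of the Eulerian polynomials -/

theorem eulerianPoly_eq_sum (n : ℕ) :
    eulerianPoly n = ∑ l ∈ permWords n, (X : ℝ[X]) ^ (listDes l + 1) := by
  rw [← sum_word (fun l => (X : ℝ[X]) ^ (listDes l + 1)), eulerianPoly]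
  simp only [des_eq_listDes]

theorem listDes_lt_length : ∀ l : List ℕ, l ≠ [] → listDes l < l.length
  | [], h => absurd rfl h
  | [_], _ => by simp [listDes]
  | a :: b :: l, _ => by
    have := listDes_lt_length (b :: l) (by simp)
    simp only [listDes, List.length_cons] at *
    split_ifs <;> omega

/-- Inserting a new largest letter into a word in all possible ways. -/
theorem sum_insertions (n : ℕ) : ∀ l : List ℕ, (∀ a ∈ l, a < n) →
    ((l.permutations'Aux n).map fun w => (X : ℝ[X]) ^ (listDes w + 1)).sum =
      ((listDes l : ℝ[X]) + 1) * X ^ (listDes l + 1) +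
        ((l.length : ℝ[X]) - (listDes l : ℝ[X])) * X ^ (listDes l + 2)
  | [], _ => by simp [listDes]
  | [y], h => by
    have hy : y < n := h y (by simp)
    simp [listDes, hy, hy.not_gt, add_comm]
  | y :: z :: l, h => by
    have hy : y < n := h y (by simp)
    have hz : z < n := h z (by simp)
    have ih := sum_insertions n (z :: l) fun a ha => h a (by simp [ha])
    simp only [List.permutations'Aux, List.map_cons, List.sum_cons, List.map_map] at ih ⊢
    simp only [Function.comp_def, listDes, if_pos hy, if_pos hz, if_neg hy.not_gt] at ih ⊢
    by_cases hzy : z < y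
    · simp only [if_pos hzy] at ih ⊢
      have e : ∀ L : List (List ℕ), (L.map fun w => (X : ℝ[X]) ^ (1 + listDes (z :: w) + 1)).sum =
          X * (L.map fun w => (X : ℝ[X]) ^ (listDes (z :: w) + 1)).sum := by
        intro L
        rw [← List.sum_map_mul_left]
        congr 2
        ext1 w
        ring
      rw [e, eq_sub_of_add_eq' ih]
      simp only [List.length_cons]
      push_cast
      ring
    · simp only [if_neg hzy, zero_add] at ih ⊢
      rw [eq_sub_of_add_eq' ih]
      simp only [List.length_cons]
      push_cast
      ring

theorem sum_permWords_succ (n : ℕ) {M : Type*} [AddCommMonoid M] (φ : List ℕ → M) :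
    ∑ l ∈ permWords (n + 1), φ l =
      ∑ l ∈ permWords n, ((l.permutations'Aux n).map φ).sum := by
  rw [permWords, permWords, List.sum_toFinset _ (nodup_permutations'_range _),
    List.sum_toFinset _ (nodup_permutations'_range _)]
  have h : (List.range (n + 1)).permutations'.Perm (n :: List.range n).permutations' := by
    rw [List.perm_permutations'_iff, List.range_succ]
    exact List.perm_append_singleton _ _
  rw [(h.map φ).sum_eq, List.permutations', List.map_flatMap, List.flatMap_def,
    List.sum_flatten, List.map_map]
  rfl

/-- A new largest letter keeps the number k of descents in k + 1 places (inside a descent or at the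
end) and raises it by one in the other n - k. -/
theorem eulerianPoly_succ (n : ℕ) : eulerianPoly (n + 1) =
    (n + 1 : ℝ[X]) * X * eulerianPoly n + X * (1 - X) * derivative (eulerianPoly n) := by
  rw [eulerianPoly_eq_sum, eulerianPoly_eq_sum, sum_permWords_succ, derivative_sum,
    Finset.mul_sum, Finset.mul_sum, ← Finset.sum_add_distrib]
  refine Finset.sum_congr rfl fun l hl => ?_
  have hl' := mem_permWords.1 hl
  rw [sum_insertions n l fun a ha => List.mem_range.1 (hl'.mem_iff.1 ha), hl'.length_eq,
    List.length_range, derivative_X_pow]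
  simp only [Nat.add_sub_cancel, map_natCast]
  push_cast
  ring

theorem natDegree_eulerianPoly_le (n : ℕ) (hn : n ≠ 0) : (eulerianPoly n).natDegree ≤ n := by
  rw [eulerianPoly_eq_sum]
  refine natDegree_sum_le_of_forall_le _ _ fun l hl => ?_
  have h := (mem_permWords.1 hl).length_eq
  rw [List.length_range] at h
  rw [natDegree_X_pow]
  have := listDes_lt_length l (by rintro rfl; exact hn h.symm)
  omega

theorem eulerianPoly_one : eulerianPoly 1 = X := by
  rw [eulerianPoly_eq_sum, permWords]
  simp [listDes]

/-! ### Stack sorting -/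

theorem stackPass_append_last {n : ℕ} (s w : List ℕ) (hw : ∀ a ∈ w, a < n) :
    stackPass (s ++ [n]) w = stackPass s w ++ [n] := by
  induction w generalizing s with
  | nil => rfl
  | cons a w ih =>
    have ha : ¬ n < a := (hw a (by simp)).not_gt
    have h1 : (s ++ [n]).takeWhile (· < a) = s.takeWhile (· < a) := by
      rw [List.takeWhile_append]
      split_ifs with h
      · have := List.takeWhile_prefix (l := s) (fun x => decide (x < a))
        rw [this.eq_of_length h]
        simp [ha]
      · rfl
    have h2 : (s ++ [n]).dropWhile (· < a) = s.dropWhile (· < a) ++ [n] := by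
      have e1 := List.takeWhile_append_dropWhile (p := fun x => decide (x < a)) (l := s ++ [n])
      have e2 := List.takeWhile_append_dropWhile (p := fun x => decide (x < a)) (l := s)
      rw [h1] at e1
      nth_rw 3 [← e2] at e1
      rw [List.append_assoc] at e1
      exact List.append_cancel_left e1
    rw [stackPass, stackPass, h1, h2, ← List.cons_append, ih _ fun b hb => hw b (by simp [hb]),
      List.append_assoc]

theorem stackPass_append_cons {n : ℕ} (s L R : List ℕ) (hs : ∀ a ∈ s, a < n)
    (hL : ∀ a ∈ L, a < n) :
    stackPass s (L ++ n :: R) = stackPass s L ++ stackPass [n] R := by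
  induction L generalizing s with
  | nil =>
    have h : ∀ a ∈ s, decide (a < n) = true := by simpa using hs
    have h1 : s.takeWhile (· < n) = s := List.takeWhile_eq_self_iff.2 h
    have h2 : s.dropWhile (· < n) = [] := List.dropWhile_eq_nil_iff.2 h
    rw [List.nil_append, stackPass, stackPass, h1, h2]
  | cons a L ih =>
    rw [List.cons_append, stackPass, stackPass, ih, List.append_assoc]
    · intro b hb
      rcases List.mem_cons.1 hb with rfl | hb
      · exact hL b (by simp)
      · exact hs b ((List.dropWhile_sublist _).subset hb)
    · exact fun b hb => hL b (by simp [hb])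

/-- The recursive description of stack sorting: `s(L n R) = s(L) s(R) n`. -/
theorem stackSort_append_cons {n : ℕ} (L R : List ℕ) (hL : ∀ a ∈ L, a < n)
    (hR : ∀ a ∈ R, a < n) :
    stackSort (L ++ n :: R) = stackSort L ++ stackSort R ++ [n] := by
  have h := stackPass_append_last [] R hR
  rw [List.nil_append] at h
  rw [stackSort, stackPass_append_cons [] L R (by simp) hL, h, List.append_assoc]
  rfl

theorem stackPass_perm (s w : List ℕ) : (stackPass s w).Perm (s ++ w) := by
  induction w generalizing s with
  | nil => simp [stackPass]
  | cons a w ih =>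
    rw [stackPass]
    refine ((ih _).append_left _).trans ?_
    rw [List.cons_append]
    refine List.perm_middle.trans ?_
    rw [← List.append_assoc, List.takeWhile_append_dropWhile]
    exact List.perm_middle.symm

theorem stackSort_perm (w : List ℕ) : (stackSort w).Perm w := by
  simpa [stackSort] using stackPass_perm [] w

theorem stackSort_concat {n : ℕ} (w : List ℕ) (hw : ∀ a ∈ w, a < n) :
    stackSort (w ++ [n]) = stackSort w ++ [n] := by
  rw [stackSort_append_cons w [] hw (by simp)]
  simp [stackSort, stackPass]

theorem iterate_stackSort_concat {n : ℕ} (k : ℕ) (w : List ℕ) (hw : ∀ a ∈ w, a < n) :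
    stackSort^[k] (w ++ [n]) = stackSort^[k] w ++ [n] := by
  induction k generalizing w with
  | zero => rfl
  | succ k ih =>
    rw [Function.iterate_succ_apply, Function.iterate_succ_apply, stackSort_concat w hw]
    exact ih _ fun a ha => hw a ((stackSort_perm w).mem_iff.1 ha)

/-- A stack-sorted nonempty word ends in its largest letter. -/
theorem exists_stackSort_eq_concat {w : List ℕ} (hw : w ≠ []) (hd : w.Nodup) :
    ∃ v m, stackSort w = v ++ [m] ∧ m ∈ w ∧ ∀ a ∈ w, a ≤ m := by
  obtain ⟨m, hm, hmax⟩ := w.toFinset.exists_max_image id (List.toFinset_nonempty_iff w |>.2 hw)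
  simp only [List.mem_toFinset, id] at hm hmax
  obtain ⟨L, R, rfl⟩ := List.append_of_mem hm
  have hd' := List.nodup_middle.1 hd
  have hlt : ∀ a ∈ L ++ R, a < m := by
    intro a ha
    refine lt_of_le_of_ne (hmax a ?_) ?_
    · rw [List.mem_append] at ha ⊢
      rcases ha with ha | ha
      · exact Or.inl ha
      · exact Or.inr (List.mem_cons_of_mem _ ha)
    · rintro rfl
      exact (List.nodup_cons.1 hd').1 ha
  exact ⟨_, m, stackSort_append_cons L R (fun a ha => hlt a (by simp [ha]))
    (fun a ha => hlt a (by simp [ha])), hm, hmax⟩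

/-- A word on `n + 1` letters, cut at its largest letter. -/
theorem exists_split_of_perm_range {n : ℕ} {w : List ℕ} (hw : w.Perm (List.range (n + 1))) :
    ∃ L R, w = L ++ n :: R ∧ (L ++ R).Perm (List.range n) ∧ (∀ a ∈ L, a < n) ∧
      ∀ a ∈ R, a < n := by
  obtain ⟨L, R, rfl⟩ := List.append_of_mem (hw.mem_iff.2 (by simp : n ∈ List.range (n + 1)))
  have h : (L ++ R).Perm (List.range n) := by
    rw [List.range_succ] at hw
    exact (List.perm_middle.symm.trans (hw.trans (List.perm_append_singleton _ _))).cons_inv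
  refine ⟨L, R, rfl, h, fun a ha => ?_, fun a ha => ?_⟩
  · exact List.mem_range.1 (h.mem_iff.1 (by simp [ha]))
  · exact List.mem_range.1 (h.mem_iff.1 (by simp [ha]))

/-- A pass puts the largest letter last for good, leaving s(L) s(R). If R is nonempty, s(R) ends in
max R, which is 0 only for R = [0], the excluded suffix; if R is empty, s(L) ends in m + 1. So the
bad suffix cannot appear at the next level. -/
theorem iterate_stackSort_of_not_suffix (m : ℕ) {w : List ℕ}
    (hw : w.Perm (List.range (m + 2))) (h : ¬ [m + 1, 0] <:+ w) :
    stackSort^[m] w = List.range (m + 2) := by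
  induction m generalizing w with
  | zero =>
    obtain ⟨L, R, rfl, hLR, -, -⟩ := exists_split_of_perm_range hw
    rw [List.range_one, List.perm_singleton, List.append_eq_singleton_iff] at hLR
    rcases hLR with ⟨rfl, rfl⟩ | ⟨rfl, rfl⟩
    · exact absurd ⟨[], rfl⟩ h
    · rfl
  | succ m ih =>
    obtain ⟨L, R, rfl, hLR, hL, hR⟩ := exists_split_of_perm_range hw
    have hsort : (stackSort L ++ stackSort R).Perm (List.range (m + 2)) :=
      ((stackSort_perm L).append (stackSort_perm R)).trans hLR
    rw [Function.iterate_succ_apply, stackSort_append_cons L R hL hR,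
      iterate_stackSort_concat m _ fun a ha => List.mem_range.1 (hsort.mem_iff.1 ha), ih hsort,
      ← List.range_succ]
    rintro ⟨v, hv⟩
    have hnd : (L ++ R).Nodup := hLR.nodup_iff.2 List.nodup_range
    rcases eq_or_ne R [] with rfl | hR0
    · have hL0 : L ≠ [] := by
        rintro rfl
        simpa using hLR.length_eq
      rw [List.append_nil] at hLR hnd
      obtain ⟨u, k, hu, -, hk⟩ := exists_stackSort_eq_concat hL0 hnd
      have h1 : k = 0 := by
        have h2 : stackSort L = v ++ [m + 1, 0] := by simpa [stackSort, stackPass] using hv.symm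
        rw [hu] at h2
        simpa using congrArg List.getLast? h2
      have := hk (m + 1) (hLR.mem_iff.2 (by simp))
      omega
    · obtain ⟨u, k, hu, hk', hk⟩ := exists_stackSort_eq_concat hR0 hnd.of_append_right
      have h1 : k = 0 := by
        rw [hu, ← List.append_assoc] at hv
        simpa using (congrArg List.getLast? hv).symm
      subst h1
      apply h
      refine ⟨L, ?_⟩
      have h2 : ∀ a ∈ R, a = 0 := fun a ha => Nat.le_zero.1 (hk a ha)
      have h3 := List.eq_replicate_iff.2 ⟨rfl, h2⟩
      have h4 := hnd.of_append_right
      rw [h3, List.nodup_replicate] at h4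
      have h5 : R.length = 1 := by
        have := List.length_pos_iff.2 hR0
        omega
      rw [h5] at h3
      rw [h3]
      rfl

/-- The bad suffix persists: v (m+2) 0 becomes s(v) 0 (m+2), and s(v) ends in m + 1. After m passes
the word still begins with 1 0. -/
theorem iterate_stackSort_ne_of_suffix (m : ℕ) {v : List ℕ}
    (hw : (v ++ [m + 1, 0]).Perm (List.range (m + 2))) :
    stackSort^[m] (v ++ [m + 1, 0]) ≠ List.range (m + 2) := by
  induction m generalizing v with
  | zero =>
    have h := hw.length_eq
    simp at h
    subst h
    decide
  | succ m ih =>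
    have hnd : (v ++ [m + 1 + 1, 0]).Nodup := hw.nodup_iff.2 List.nodup_range
    have hv : (v ++ [0]).Perm (List.range (m + 2)) := by
      rw [List.range_succ] at hw
      exact (List.perm_middle.symm.trans (hw.trans (List.perm_append_singleton _ _))).cons_inv
    have hlt : ∀ a ∈ v, a < m + 2 := fun a ha =>
      List.mem_range.1 (hv.mem_iff.1 (by simp [ha]))
    have hv0 : v ≠ [] := by
      rintro rfl
      simpa using hv.length_eq
    obtain ⟨u, k, hu, hk', hk⟩ := exists_stackSort_eq_concat hv0 hnd.of_append_left
    have hkm : k = m + 1 := by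
      have h1 : m + 1 ∈ v ++ [0] := hv.mem_iff.2 (by simp)
      have h2 : m + 1 ∈ v := by simpa using h1
      have := hk _ h2
      have := hlt k hk'
      omega
    subst hkm
    have hs : stackSort (v ++ [m + 1 + 1, 0]) = u ++ [m + 1, 0] ++ [m + 2] := by
      rw [stackSort_append_cons v [0] hlt (by simp), hu]
      simp [stackSort, stackPass]
    have hp : (u ++ [m + 1, 0]).Perm (List.range (m + 2)) := by
      refine List.Perm.trans ?_ hv
      have := ((stackSort_perm v).append_right [0])
      rw [hu] at this
      simpa using this
    rw [Function.iterate_succ_apply, hs,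
      iterate_stackSort_concat m _ fun a ha => List.mem_range.1 (hp.mem_iff.1 ha)]
    intro h
    rw [List.range_succ (n := m + 2)] at h
    exact ih hp (List.append_cancel_right h)

theorem iterate_stackSort_eq_range_iff (m : ℕ) {w : List ℕ} (hw : w.Perm (List.range (m + 2))) :
    stackSort^[m] w = List.range (m + 2) ↔ ¬ [m + 1, 0] <:+ w := by
  refine ⟨?_, iterate_stackSort_of_not_suffix m hw⟩
  rintro h ⟨v, rfl⟩
  exact iterate_stackSort_ne_of_suffix m hw h

/-! ### Counting the non-sortable permutations by descents -/

theorem listDes_map_succ : ∀ l : List ℕ, listDes (l.map Nat.succ) = listDes l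
  | [] => rfl
  | [_] => rfl
  | a :: b :: l => by
    have := listDes_map_succ (b :: l)
    simp only [List.map_cons, listDes, Nat.succ_lt_succ_iff] at *
    rw [this]

theorem listDes_append_max_zero {n : ℕ} (hn : 0 < n) : ∀ l : List ℕ, (∀ a ∈ l, a < n) →
    listDes (l ++ [n, 0]) = listDes l + 1
  | [], _ => by simp [listDes, hn]
  | [a], h => by
    have : ¬ n < a := (h a (by simp)).not_gt
    simp [listDes, hn, this]
  | a :: b :: l, h => by
    have := listDes_append_max_zero hn (b :: l) fun c hc => h c (by simp [hc])
    simp only [List.cons_append, listDes] at *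
    rw [this]
    ring

/-- Deleting the suffix and lowering the remaining letters by one gives a word of size m. Only the
suffix itself contributes a descent, which matches the extra 1 in the Eulerian exponent. -/
theorem sum_words_with_suffix (m : ℕ) :
    ∑ l ∈ permWords (m + 2) with [m + 1, 0] <:+ l, (X : ℝ[X]) ^ listDes l =
      eulerianPoly m := by
  rw [eulerianPoly_eq_sum]
  have hr : (List.range (m + 2)).Perm ((List.range m).map Nat.succ ++ [m + 1, 0]) := by
    rw [List.range_succ, List.range_succ_eq_map]
    exact (List.perm_append_comm (l₁ := [0])
      (l₂ := (List.range m).map Nat.succ ++ [m + 1])).trans (by simp)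
  symm
  refine Finset.sum_bij (fun w _ => w.map Nat.succ ++ [m + 1, 0]) ?_ ?_ ?_ ?_
  · intro w hw
    rw [mem_permWords] at hw
    rw [Finset.mem_filter, mem_permWords]
    exact ⟨((hw.map _).append_right _).trans hr.symm, _, rfl⟩
  · intro w _ w' _ h
    exact List.map_injective_iff.2 Nat.succ_injective (List.append_cancel_right h)
  · intro l hl
    rw [Finset.mem_filter, mem_permWords] at hl
    obtain ⟨hl, v, rfl⟩ := hl
    have hv : v.Perm ((List.range m).map Nat.succ) :=
      (List.perm_append_right_iff _).1 (hl.trans hr)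
    have h2 : ∀ a ∈ v, (Nat.succ ∘ Nat.pred) a = a := by
      intro a ha
      have := hv.mem_iff.1 ha
      obtain ⟨b, -, rfl⟩ := List.mem_map.1 this
      rfl
    have h3 : (v.map Nat.pred).map Nat.succ = v := by
      rw [List.map_map, List.map_congr_left h2]
      simp
    refine ⟨v.map Nat.pred, ?_, by rw [h3]⟩
    rw [mem_permWords]
    have := hv.map Nat.pred
    simpa [Function.comp_def] using this
  · intro w hw
    rw [mem_permWords] at hw
    rw [listDes_append_max_zero (Nat.succ_pos m), listDes_map_succ]
    intro a ha
    obtain ⟨b, hb, rfl⟩ := List.mem_map.1 ha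
    exact Nat.succ_lt_succ (List.mem_range.1 (hw.mem_iff.1 hb))

theorem des_lt {n : ℕ} (hn : n ≠ 0) (π : Equiv.Perm (Fin n)) : des π < n := by
  have h : (word π).length = n := by simp [word]
  rw [des_eq_listDes]
  refine (listDes_lt_length _ ?_).trans_eq h
  intro h0
  rw [h0] at h
  exact hn h.symm

theorem stackPoly_eq_sum {n : ℕ} (hn : n ≠ 0) (t : ℕ) : stackPoly n t =
    ∑ π : Equiv.Perm (Fin n) with IsStackSortable t π, (X : ℝ[X]) ^ des π := by
  have h : ∀ π ∈ Finset.univ.filter (fun π : Equiv.Perm (Fin n) => IsStackSortable t π),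
      des π ∈ Finset.range n := fun π _ => Finset.mem_range.2 (des_lt hn π)
  rw [← Finset.sum_fiberwise_of_maps_to h, stackPoly]
  refine Finset.sum_congr rfl fun k _ => ?_
  rw [Finset.filter_filter, stackNumber,
    Finset.sum_congr rfl (g := fun _ => (X : ℝ[X]) ^ k) fun π hπ => by
      rw [(Finset.mem_filter.1 hπ).2.2], Finset.sum_const, nsmul_eq_mul, map_natCast]

theorem X_mul_stackPoly (m : ℕ) :
    X * stackPoly (m + 2) m = eulerianPoly (m + 2) - X * eulerianPoly m := by
  rw [← sum_words_with_suffix m, eulerianPoly_eq_sum (m + 2), stackPoly_eq_sum (by omega),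
    eq_sub_iff_add_eq, ← mul_add, Finset.sum_filter]
  have h := sum_word (n := m + 2) (fun l => if stackSort^[m] l = List.range (m + 2)
    then (X : ℝ[X]) ^ listDes l else 0)
  have h' : ∀ π : Equiv.Perm (Fin (m + 2)),
      (if IsStackSortable m π then (X : ℝ[X]) ^ des π else 0) =
      if stackSort^[m] (word π) = List.range (m + 2) then (X : ℝ[X]) ^ listDes (word π) else 0 := by
    intro π
    rw [des_eq_listDes]
    rfl
  rw [Finset.sum_congr rfl fun π _ => h' π, h, ← Finset.sum_filter]
  rw [Finset.filter_congr fun l hl => iterate_stackSort_eq_range_iff m (mem_permWords.1 hl),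
    add_comm, Finset.sum_filter_add_sum_filter_not, Finset.mul_sum]
  exact Finset.sum_congr rfl fun l _ => (pow_succ' _ _).symm

/-! ### Pólya frequency sequences of real-rooted polynomials -/

theorem isPF_single {c : ℝ} (hc : 0 ≤ c) : IsPF fun k => if k = 0 then c else 0 := by
  intro r f g hf hg
  have e : (Matrix.of fun i j : ℕ => if j ≤ i then (if i - j = 0 then c else 0) else 0) =
      c • (1 : Matrix ℕ ℕ ℝ) := by
    ext i j
    rcases lt_trichotomy i j with h | h | h
    · simp [h.not_ge, h.ne]
    · simp [h]
    · have : i - j ≠ 0 := by omega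
      simp [h.le, this, h.ne']
  rw [e]
  change 0 ≤ (c • (1 : Matrix ℕ ℕ ℝ).submatrix f g).det
  rw [Matrix.det_smul]
  refine mul_nonneg (pow_nonneg hc _) ?_
  -- Either some row of the minor is zero, or the rows and columns chosen coincide and the minor is
  -- that of an identity matrix.
  by_cases h : ∃ i, ∀ j, f i ≠ g j
  · obtain ⟨i, hi⟩ := h
    rw [Matrix.det_eq_zero_of_row_eq_zero i]
    intro j
    simp [Matrix.one_apply_ne (hi j)]
  · push Not at h
    have hfg : f = g := by
      rw [← hf.range_inj hg]
      refine Set.eq_of_subset_of_ncard_le ?_ ?_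
      · rintro _ ⟨i, rfl⟩
        obtain ⟨j, hj⟩ := h i
        exact ⟨j, hj.symm⟩
      · rw [Set.ncard_range_of_injective hf.injective, Set.ncard_range_of_injective hg.injective]
    rw [hfg, Matrix.submatrix_one g hg.injective, Matrix.det_one]
    exact zero_le_one

/-- This is multiplication of the generating function by X + r. Each column of the new matrix is r
times an old column plus the next one, so a minor expands into nonnegative multiples of old minors.
-/
theorem IsPF.shift_add {a : ℕ → ℝ} (ha : IsPF a) {r : ℝ} (hr : 0 ≤ r) :
    IsPF fun k => (if k = 0 then 0 else a (k - 1)) + r * a k := by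
  intro n f g hf hg
  set M : Matrix ℕ ℕ ℝ := Matrix.of fun i j => if j ≤ i then a (i - j) else 0 with hM
  have e : (Matrix.of fun i j : ℕ =>
      if j ≤ i then (if i - j = 0 then 0 else a (i - j - 1)) + r * a (i - j) else 0) =
      Matrix.of fun i j => r * M i j + M i (j + 1) := by
    ext i j
    simp only [hM, Matrix.of_apply]
    rcases lt_trichotomy i j with h | h | h
    · simp [h.not_ge, (show ¬ j + 1 ≤ i by omega)]
    · simp [h]
    · simp [h.le, (show i - j ≠ 0 by omega), (show j + 1 ≤ i by omega), Nat.sub_sub]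
      ring
  rw [e, ← Matrix.det_transpose]
  have e2 : ((Matrix.of fun i j => r * M i j + M i (j + 1)).submatrix f g).transpose =
      ((fun j i => r * M (f i) (g j)) + fun j i => M (f i) (g j + 1) : Fin n → Fin n → ℝ) := rfl
  have e3 := (Matrix.detRowAlternating (n := Fin n) (R := ℝ)).toMultilinearMap.map_add_univ
    (fun j i => r * M (f i) (g j)) fun j i => M (f i) (g j + 1)
  rw [e2]
  change 0 ≤ (Matrix.detRowAlternating (n := Fin n) (R := ℝ)).toMultilinearMap _
  rw [e3]
  refine Finset.sum_nonneg fun s _ => ?_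
  -- The columns in s keep their index with weight r; the others move one to the right.
  set g' : Fin n → ℕ := fun j => g j + if j ∈ s then 0 else 1 with hg'
  have e4 : (s.piecewise (fun j i => r * M (f i) (g j)) fun j i => M (f i) (g j + 1)) =
      fun j => (if j ∈ s then r else 1) • fun i => M (f i) (g' j) := by
    funext j i
    by_cases hj : j ∈ s <;> simp [hj, hg']
  have e5 := (Matrix.detRowAlternating (n := Fin n) (R := ℝ)).toMultilinearMap.map_smul_univ
    (fun j => if j ∈ s then r else 1) fun j i => M (f i) (g' j)
  rw [e4, e5]
  refine mul_nonneg (Finset.prod_nonneg fun j _ => by split_ifs <;> simp [hr]) ?_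
  change 0 ≤ (M.submatrix f g').transpose.det
  -- A shift by at most one can break strict monotonicity only by making two columns equal, and then
  -- the determinant vanishes.
  by_cases hmono : StrictMono g'
  · rw [Matrix.det_transpose]
    exact ha n f g' hf hmono
  · simp only [StrictMono, not_forall, not_lt] at hmono
    obtain ⟨j, k, hjk, hle⟩ := hmono
    have hlt := hg hjk
    have heq : g' j = g' k := by
      refine le_antisymm ?_ hle
      simp only [hg']
      split_ifs <;> omega
    rw [Matrix.det_zero_of_row_eq hjk.ne]
    ext i
    simp [heq]

/-- The coefficients of a polynomial with nonnegative leading coefficient and only real nonpositive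
zeros form a Pólya frequency sequence. -/
theorem isPF_coeff {p : ℝ[X]} (hp : p.Splits) (hlc : 0 ≤ p.leadingCoeff)
    (hroots : ∀ x ∈ p.roots, x ≤ 0) : IsPF p.coeff := by
  have key : ∀ s : Multiset ℝ, (∀ x ∈ s, x ≤ 0) →
      IsPF (C p.leadingCoeff * (s.map fun x => X - C x).prod).coeff := by
    intro s
    induction s using Multiset.induction_on with
    | empty =>
      intro _
      have := isPF_single hlc
      convert this using 1
      funext k
      simp [coeff_C]
    | cons x s ih =>
      intro hs
      have h1 := (ih fun y hy => hs y (Multiset.mem_cons_of_mem hy)).shift_add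
        (r := -x) (by linarith [hs x (Multiset.mem_cons_self x s)])
      convert h1 using 1
      funext k
      rw [Multiset.map_cons, Multiset.prod_cons, mul_left_comm, sub_mul, coeff_sub, coeff_C_mul]
      cases k with
      | zero => simp
      | succ k =>
        rw [coeff_X_mul]
        simp
        ring
  rw [hp.eq_prod_roots]
  exact key _ hroots

/-! ### The change of variable `u = (1 + x) / (1 - x)` -/

theorem eulerianCore_succ (m : ℕ) :
    eulerianCore (m + 1) = derivative ((X ^ 2 - 1) * eulerianCore m) := by
  simp only [eulerianCore, tilt, derivative_mul, derivative_sub, derivative_X_pow, derivative_one]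
  simp only [Nat.cast_ofNat, map_ofNat]
  ring

/-- Induction by differentiating the formula itself: with du/dx = 2/(1 - x)², the Eulerian
recurrence turns into `eulerianCore_succ`. -/
theorem eval_eulerianPoly_succ (m : ℕ) {x : ℝ} (hx : x ≠ 1) :
    (eulerianPoly (m + 1)).eval x = ((1 - x) / 2) ^ (m + 2) *
      ((X ^ 2 - 1) * eulerianCore m).eval ((1 + x) / (1 - x)) := by
  induction m generalizing x with
  | zero =>
    have h : 1 - x ≠ 0 := sub_ne_zero.2 hx.symm
    simp [eulerianPoly_one, eulerianCore]
    field_simp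
    ring
  | succ m ih =>
    have h : 1 - x ≠ 0 := sub_ne_zero.2 hx.symm
    set H := (X ^ 2 - 1) * eulerianCore m with hH
    have hu : HasDerivAt (fun y : ℝ => (1 + y) / (1 - y)) (2 / (1 - x) ^ 2) x := by
      have h1 := ((hasDerivAt_id x).const_add 1).div ((hasDerivAt_id x).const_sub 1) h
      refine h1.congr_deriv ?_
      simp only [id]
      ring
    have hw : HasDerivAt (fun y : ℝ => ((1 - y) / 2) ^ (m + 2))
        ((m + 2 : ℝ) * ((1 - x) / 2) ^ (m + 1) * (-1 / 2)) x := by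
      have h1 := (((hasDerivAt_id x).const_sub 1).div_const 2).pow (m + 2)
      refine h1.congr_deriv ?_
      simp
    have hd := hw.mul ((H.hasDerivAt ((1 + x) / (1 - x))).comp x hu)
    have heq : (fun y => (eulerianPoly (m + 1)).eval y) =ᶠ[nhds x]
        fun y => ((1 - y) / 2) ^ (m + 2) * H.eval ((1 + y) / (1 - y)) := by
      filter_upwards [isOpen_ne.mem_nhds hx] with y hy using ih hy
    have hder := ((eulerianPoly (m + 1)).hasDerivAt x).unique (hd.congr_of_eventuallyEq heq)
    rw [eulerianPoly_succ, eval_add, eval_mul, eval_mul, eval_mul, hder, ih hx, eulerianCore_succ,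
      ← hH]
    simp only [eval_add, eval_natCast, eval_one, eval_X, eval_sub, eval_mul, eval_pow,
      Function.comp]
    push_cast
    generalize eval ((1 + x) / (1 - x)) H = a
    generalize eval ((1 + x) / (1 - x)) (derivative H) = b
    field_simp
    ring

theorem X_mul_eval_eulerianPolyTDivX (n : ℕ) (t x : ℝ) :
    x * (eulerianPolyTDivX n t).eval x = (eulerianPolyT n t).eval x := by
  rw [← X_mul_eulerianPolyTDivX, eval_mul, eval_X]

/-- The factor x is absorbed exactly, because x = (u² - 1) ((1 - x)/2)². -/
theorem eval_eulerianPolyTDivX (m : ℕ) (t : ℝ) {x : ℝ} (h0 : x ≠ 0) (h1 : x ≠ 1) :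
    (eulerianPolyTDivX (m + 3) t).eval x = ((1 - x) / 2) ^ (m + 2) *
      (legendreOp t (eulerianCore m)).eval ((1 + x) / (1 - x)) := by
  have h : 1 - x ≠ 0 := sub_ne_zero.2 h1.symm
  apply mul_left_cancel₀ h0
  rw [X_mul_eval_eulerianPolyTDivX, eulerianPolyT, legendreOp_eq_tilt_tilt,
    show m + 3 - 2 = m + 1 by omega]
  simp only [eval_add, eval_mul, eval_X, eval_C, eval_eulerianPoly_succ _ h1, eval_sub, eval_pow,
    eval_one]
  rw [show eulerianCore (m + 2) = tilt 2 (tilt 2 (eulerianCore m)) from rfl]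
  generalize eval ((1 + x) / (1 - x)) (tilt 2 (tilt 2 (eulerianCore m))) = a
  generalize eval ((1 + x) / (1 - x)) (eulerianCore m) = b
  field_simp
  ring

/-! ### From chains in (-1, 1) to the zeros of A_n(t, x)/x -/

theorem natDegree_eulerianPolyT_le (m : ℕ) (t : ℝ) :
    (eulerianPolyT (m + 3) t).natDegree ≤ m + 3 := by
  refine natDegree_add_le_of_degree_le (natDegree_eulerianPoly_le _ (by omega)) ?_
  have h1 := natDegree_eulerianPoly_le (m + 3 - 2) (by omega)
  have h2 : ((C t * X : ℝ[X])).natDegree ≤ 1 := by compute_degree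
  have h3 := natDegree_mul_le (p := (C t * X : ℝ[X])) (q := eulerianPoly (m + 3 - 2))
  omega

theorem natDegree_eulerianPolyTDivX_le (m : ℕ) (t : ℝ) :
    (eulerianPolyTDivX (m + 3) t).natDegree ≤ m + 2 := by
  rw [eulerianPolyTDivX, natDegree_divX_eq_natDegree_tsub_one]
  have := natDegree_eulerianPolyT_le m t
  omega

/-- The inverse `u ↦ (u - 1) / (u + 1)` of the change of variable. -/
noncomputable def cayley (u : ℝ) : ℝ := (u - 1) / (u + 1)

theorem cayley_neg {u : ℝ} (h1 : -1 < u) (h2 : u < 1) : cayley u < 0 :=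
  div_neg_of_neg_of_pos (by linarith) (by linarith)

theorem cayley_lt {u v : ℝ} (h1 : -1 < u) (h2 : u < v) : cayley u < cayley v := by
  rw [cayley, cayley, div_lt_div_iff₀ (by linarith) (by linarith)]
  nlinarith

theorem eval_cayley_eulerianPolyTDivX (m : ℕ) (t : ℝ) {u : ℝ} (h1 : -1 < u) (h2 : u < 1) :
    (eulerianPolyTDivX (m + 3) t).eval (cayley u) = ((1 - cayley u) / 2) ^ (m + 2) *
      (legendreOp t (eulerianCore m)).eval u := by
  have h := cayley_neg h1 h2
  rw [eval_eulerianPolyTDivX m t h.ne (by linarith)]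
  congr 2
  have : u + 1 ≠ 0 := by linarith
  rw [cayley, div_eq_iff]
  · field_simp
    ring
  · rw [one_sub_div this]
    refine div_ne_zero ?_ this
    norm_num

/-- The zeros of `A_n(t, x) / x`, in increasing order, coming from a chain. -/
noncomputable def cayleyRoots (d : ℕ) (w : ℕ → ℝ) (i : Fin d) : ℝ := cayley (w (d - i))

theorem Ladder.strictMono_cayleyRoots {d : ℕ} {w : ℕ → ℝ} (hw : Ladder d w) :
    StrictMono (cayleyRoots d w) := by
  intro i j hij
  have hi := i.2
  have hj := j.2
  have hij' : (i : ℕ) < j := hij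
  refine cayley_lt ?_ (hw.lt_of_lt (by omega) (by omega))
  rw [← hw.bot]
  exact hw.lt_of_lt (by omega) (by omega)

theorem Ladder.inner {d : ℕ} {w : ℕ → ℝ} (hw : Ladder d w) (i : Fin d) :
    -1 < w (d - i) ∧ w (d - i) < 1 := by
  have hi := i.2
  constructor
  · rw [← hw.bot]
    exact hw.lt_of_lt (by omega) (by omega)
  · rw [← hw.top]
    exact hw.lt_of_lt (by omega) (by omega)

theorem roots_eq_of_strictMono {p : ℝ[X]} {d : ℕ} (hp : p ≠ 0) (hd : p.natDegree ≤ d)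
    {β : Fin d → ℝ} (hβ : StrictMono β) (hroot : ∀ i, p.eval (β i) = 0) :
    p.roots = Multiset.map β Finset.univ.val ∧ p.Splits := by
  have hnd : (Multiset.map β Finset.univ.val).Nodup := Finset.univ.nodup.map hβ.injective
  have hle : Multiset.map β Finset.univ.val ≤ p.roots := by
    rw [Multiset.le_iff_subset hnd]
    intro x hx
    obtain ⟨i, -, rfl⟩ := Multiset.mem_map.1 hx
    exact (mem_roots hp).2 (hroot i)
  have hcard : Multiset.card (Multiset.map β Finset.univ.val) = d := by simp
  have h1 := p.card_roots'
  have heq := Multiset.eq_of_le_of_card_le hle (by omega)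
  refine ⟨heq.symm, ?_⟩
  rw [splits_iff_card_roots]
  refine le_antisymm h1 ?_
  rw [← heq, hcard]
  exact hd

section
variable {m : ℕ} {t : ℝ} {w : ℕ → ℝ}
  (hw : RootLadder (legendreOp t (eulerianCore m)) (m + 2) w)
include hw

theorem RootLadder.eulerianPolyTDivX_ne_zero : eulerianPolyTDivX (m + 3) t ≠ 0 := by
  intro h
  have h1 : w (0 + 1) < 1 := hw.lt_one (by omega)
  have h2 : -1 < w (0 + 1) := hw.neg_one_lt (by omega)
  -- The midpoint of the largest zero and 1, where the transformed polynomial is positive.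
  have h3 := eval_cayley_eulerianPolyTDivX m t (u := (w (0 + 1) + 1) / 2) (by linarith)
    (by linarith)
  have h4 := hw.sign (Nat.zero_le _) (x := (w (0 + 1) + 1) / 2) (by linarith)
    (by rw [hw.top]; linarith)
  have h5 := cayley_neg (u := (w (0 + 1) + 1) / 2) (by linarith) (by linarith)
  rw [h, eval_zero] at h3
  rw [pow_zero, one_mul] at h4
  have : 0 < (1 - cayley ((w (0 + 1) + 1) / 2)) / 2 := by linarith
  have := mul_pos (pow_pos this (m + 2)) h4
  linarith

theorem RootLadder.eval_cayleyRoots (i : Fin (m + 2)) :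
    (eulerianPolyTDivX (m + 3) t).eval (cayleyRoots (m + 2) w i) = 0 := by
  obtain ⟨h1, h2⟩ := hw.inner i
  have hi := i.2
  have h3 := hw.root (m + 2 - i - 1) (by omega)
  rw [show m + 2 - i - 1 + 1 = m + 2 - (i : ℕ) by omega] at h3
  rw [cayleyRoots, eval_cayley_eulerianPolyTDivX m t h1 h2, h3, mul_zero]

theorem RootLadder.roots_eulerianPolyTDivX :
    (eulerianPolyTDivX (m + 3) t).roots =
        Multiset.map (cayleyRoots (m + 2) w) Finset.univ.val ∧
      (eulerianPolyTDivX (m + 3) t).Splits :=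
  roots_eq_of_strictMono hw.eulerianPolyTDivX_ne_zero (natDegree_eulerianPolyTDivX_le m t)
    hw.strictMono_cayleyRoots hw.eval_cayleyRoots

theorem RootLadder.root_neg : ∀ x ∈ (eulerianPolyTDivX (m + 3) t).roots, x < 0 := by
  intro x hx
  rw [hw.roots_eulerianPolyTDivX.1] at hx
  obtain ⟨i, -, rfl⟩ := Multiset.mem_map.1 hx
  exact cayley_neg (hw.inner i).1 (hw.inner i).2

end

theorem isRealSimpleRooted_eulerianPolyT {t : ℝ} (ht : -2 < t) (m : ℕ) :
    IsRealSimpleRooted (eulerianPolyT (m + 3) t) := by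
  obtain ⟨w, hw⟩ := exists_rootLadder_legendreOp t ht m
  obtain ⟨h1, h2⟩ := hw.roots_eulerianPolyTDivX
  have hne : X * eulerianPolyTDivX (m + 3) t ≠ 0 :=
    mul_ne_zero X_ne_zero hw.eulerianPolyTDivX_ne_zero
  rw [← X_mul_eulerianPolyTDivX]
  refine ⟨⟨hne, Splits.X.mul h2⟩, ?_⟩
  rw [roots_mul hne, roots_X, Multiset.singleton_add, Multiset.nodup_cons]
  refine ⟨fun h => (hw.root_neg 0 h).false, ?_⟩
  rw [h1]
  exact Finset.univ.nodup.map hw.strictMono_cayleyRoots.injective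

theorem strictlyInterlaces_eulerianPolyTDivX {t : ℝ} (ht : -2 < t) (ht' : t ≤ 3) (m : ℕ) :
    StrictlyInterlaces (eulerianPolyTDivX (m + 3) t) (eulerianPolyTDivX (m + 4) t) := by
  obtain ⟨w, s, hw, hs, hsw⟩ := exists_interlacing_rootLadder_legendreOp t ht ht' m
  obtain ⟨h1, h2⟩ := hw.roots_eulerianPolyTDivX
  obtain ⟨h3, h4⟩ := hs.roots_eulerianPolyTDivX
  have hlt : ∀ i : Fin (m + 2), cayleyRoots (m + 3) s i.castSucc < cayleyRoots (m + 2) w i ∧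
      cayleyRoots (m + 2) w i < cayleyRoots (m + 3) s i.succ := by
    intro i
    have hi := i.2
    have h5 := (hsw (m + 2 - i) (by omega)).2
    have h6 := (hsw (m + 2 - i - 1) (by omega)).1
    have h7 := (hs.inner i.castSucc).1
    rw [show m + 2 - (i : ℕ) + 1 = m + 3 - (i : ℕ) by omega] at h5
    rw [show m + 2 - (i : ℕ) - 1 + 1 = m + 2 - (i : ℕ) by omega] at h6
    refine ⟨cayley_lt h7 h5, ?_⟩
    rw [cayleyRoots, cayleyRoots, Fin.val_succ, show m + 3 - ((i : ℕ) + 1) = m + 2 - i by omega]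
    exact cayley_lt (hw.inner i).1 h6
  refine ⟨⟨⟨hw.eulerianPolyTDivX_ne_zero, h2⟩, ⟨hs.eulerianPolyTDivX_ne_zero, h4⟩, m + 2,
    cayleyRoots (m + 2) w, cayleyRoots (m + 3) s, hw.strictMono_cayleyRoots.monotone,
    hs.strictMono_cayleyRoots.monotone, h1, h3, fun i => ⟨(hlt i).1.le, (hlt i).2.le⟩⟩, ?_⟩
  rintro x ⟨hx1, hx2⟩
  have hx1' := (mem_roots hw.eulerianPolyTDivX_ne_zero).2 hx1
  have hx2' := (mem_roots hs.eulerianPolyTDivX_ne_zero).2 hx2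
  rw [h1] at hx1'
  rw [h3] at hx2'
  obtain ⟨i, -, rfl⟩ := Multiset.mem_map.1 hx1'
  obtain ⟨j, -, hj⟩ := Multiset.mem_map.1 hx2'
  -- Each zero of the second polynomial lies at or below the left neighbour of the i-th zero of the
  -- first, or at or above its right neighbour.
  rcases le_or_gt j i.castSucc with h | h
  · have := hs.strictMono_cayleyRoots.monotone h
    linarith [(hlt i).1]
  · have := hs.strictMono_cayleyRoots.monotone (Fin.castSucc_lt_iff_succ_le.1 h)
    linarith [(hlt i).2]

/-! ### The stack-sorting polynomials as the case t = -1 -/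

theorem stackPoly_eq_eulerianPolyTDivX (m : ℕ) :
    stackPoly (m + 3) (m + 1) = eulerianPolyTDivX (m + 3) (-1) := by
  apply mul_left_cancel₀ (X_ne_zero (R := ℝ))
  rw [X_mul_stackPoly (m + 1), X_mul_eulerianPolyTDivX, eulerianPolyT,
    show m + 3 - 2 = m + 1 by omega]
  simp
  ring

/-- The case n = 2 of the PF statement lies outside the range of A_n(t, x) and is computed directly.
-/
theorem stackPoly_two_zero : stackPoly 2 0 = 1 := by
  have h0 : eulerianPoly 0 = X := by
    rw [eulerianPoly_eq_sum, permWords]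
    simp [listDes]
  apply mul_left_cancel₀ (X_ne_zero (R := ℝ))
  rw [X_mul_stackPoly 0, h0, eulerianPoly_succ, eulerianPoly_one]
  simp
  ring

theorem coeff_stackPoly (n t k : ℕ) :
    (stackPoly n t).coeff k = if k < n then (stackNumber t n k : ℝ) else 0 := by
  simp [stackPoly, finsetSum_coeff, coeff_X_pow]

theorem isFinitePF_stackNumber {n t : ℕ} (h : (stackPoly n t).Splits)
    (hroots : ∀ x ∈ (stackPoly n t).roots, x ≤ 0) :
    IsFinitePF fun k : Fin n => (stackNumber t n (k : ℕ) : ℝ) := by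
  have hlc : 0 ≤ (stackPoly n t).leadingCoeff := by
    rw [leadingCoeff, coeff_stackPoly]
    split_ifs <;> simp
  have h1 := isPF_coeff h hlc hroots
  have e : (stackPoly n t).coeff =
      fun k => if h : k < n then (stackNumber t n k : ℝ) else 0 := by
    funext k
    rw [coeff_stackPoly]
    split_ifs <;> rfl
  rw [e] at h1
  exact h1

theorem isFinitePF_stackNumber_sub_two (m : ℕ) :
    IsFinitePF fun k : Fin (m + 2) => (stackNumber m (m + 2) (k : ℕ) : ℝ) := by
  cases m with
  | zero => exact isFinitePF_stackNumber (by simp [stackPoly_two_zero]) (by simp [stackPoly_two_zero])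
  | succ m =>
    obtain ⟨w, hw⟩ := exists_rootLadder_legendreOp (-1) (by norm_num) m
    apply isFinitePF_stackNumber
    · rw [stackPoly_eq_eulerianPolyTDivX]
      exact hw.roots_eulerianPolyTDivX.2
    · rw [stackPoly_eq_eulerianPolyTDivX]
      exact fun x hx => (hw.root_neg x hx).le

end StackEulerian

theorem mainTheorem6 :
    (∀ (t : ℝ) (n : ℕ), -2 < t → 2 < n →
      StackEulerian.IsRealSimpleRooted (StackEulerian.eulerianPolyT n t)) ∧
    (∀ (t : ℝ) (n : ℕ), -2 < t → t ≤ 3 → 2 < n →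
      StackEulerian.StrictlyInterlaces
        (StackEulerian.eulerianPolyTDivX n t) (StackEulerian.eulerianPolyTDivX (n + 1) t)) ∧
    (∀ n : ℕ, 2 ≤ n →
      StackEulerian.IsFinitePF
        (fun k : Fin n => (StackEulerian.stackNumber (n - 2) n (k : ℕ) : ℝ))) ∧
    (∀ n : ℕ, 2 < n →
      StackEulerian.StrictlyInterlaces
        (StackEulerian.stackPoly n (n - 2)) (StackEulerian.stackPoly (n + 1) (n - 1))) := by
  refine ⟨fun t n ht hn => ?_, fun t n ht ht' hn => ?_, fun n hn => ?_, fun n hn => ?_⟩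
  · obtain ⟨m, rfl⟩ := Nat.exists_eq_add_of_le' (show 3 ≤ n from hn)
    exact StackEulerian.isRealSimpleRooted_eulerianPolyT ht m
  · obtain ⟨m, rfl⟩ := Nat.exists_eq_add_of_le' (show 3 ≤ n from hn)
    exact StackEulerian.strictlyInterlaces_eulerianPolyTDivX ht ht' m
  · obtain ⟨m, rfl⟩ := Nat.exists_eq_add_of_le' hn
    exact StackEulerian.isFinitePF_stackNumber_sub_two m
  · obtain ⟨m, rfl⟩ := Nat.exists_eq_add_of_le' (show 3 ≤ n from hn)
    have h := StackEulerian.strictlyInterlaces_eulerianPolyTDivX (t := -1) (by norm_num)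
      (by norm_num) m
    rw [← StackEulerian.stackPoly_eq_eulerianPolyTDivX,
      ← StackEulerian.stackPoly_eq_eulerianPolyTDivX (m + 1)] at h
    exact h
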